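/- Let $l,n$ be positive integers, let $\mathcal V=\mathcal M_{l,1}^n$ be the space of $n$-tuples of column vectors in $\mathbb C^l$ (equivalently, of complex $l\times n$ matrices), and let $G=\mathrm{SL}_l(\mathbb C)$ act on $\mathcal V$ by simultaneous left multiplication. Let $\mathbb C[\mathcal V]^G$ be the algebra of $G$-invariant polynomial functions on $\mathcal V$, and let $$\mathcal S_{G,\mathcal V}=\{(v,w)\in\mathcal V^2 : f(v)=f(w)\ \text{for all } f\in\mathbb C[\mathcal V]^G\}$$ be the separating variety, a Zariski closed subset of $\mathcal V^2$. (a) Suppose $l\ge 3$ and $n\ge l+1$. Then $\mathcal S_{G,\mathcal V}$ has exactly two irreducible components, of dimensions $ln+l^2-1$ and $2(n+1)(l-1)$ respectively. Their intersection is a closed subvariety of dimension at most $ln+l^2-2$, with equality if $l=3$. (b) Suppose $l=2$. Then $\mathcal S_{G,\mathcal V}$ is irreducible. -/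

import Mathlib

noncomputable section

namespace SepVar

/-- Complex affine space with coordinates indexed by `σ`. This is a type synonym of `σ → ℂ`
which carries the Zariski topology (and not the Euclidean one). -/
def ZariskiSpace (σ : Type) : Type := σ → ℂ

/-- The Zariski topology: the closed sets are the zero loci of ideals of polynomials. -/
instance zariskiTopology (σ : Type) : TopologicalSpace (ZariskiSpace σ) :=
  TopologicalSpace.ofClosed
    {Z : Set (σ → ℂ) | ∃ I : Ideal (MvPolynomial σ ℂ), Z = MvPolynomial.zeroLocus ℂ I}
    ⟨⊤, MvPolynomial.zeroLocus_top.symm⟩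
    (by
      intro A hA
      refine ⟨sSup {I | MvPolynomial.zeroLocus ℂ I ∈ A}, ?_⟩
      refine Set.Subset.antisymm ?_ ?_
      · refine MvPolynomial.le_zeroLocus_iff_le_vanishingIdeal.2 (sSup_le fun I hI => ?_)
        exact MvPolynomial.le_zeroLocus_iff_le_vanishingIdeal.1 (Set.sInter_subset_of_mem hI)
      · intro x hx Z hZ
        obtain ⟨I, rfl⟩ := hA hZ
        exact MvPolynomial.zeroLocus_anti_mono (le_sSup hZ) hx)
    (by
      rintro _ ⟨I, rfl⟩ _ ⟨J, rfl⟩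
      refine ⟨I * J, Set.Subset.antisymm ?_ ?_⟩
      · rintro x (hx | hx)
        · exact MvPolynomial.zeroLocus_anti_mono Ideal.mul_le_left hx
        · exact MvPolynomial.zeroLocus_anti_mono Ideal.mul_le_right hx
      · intro x hx
        by_contra h
        obtain ⟨hI, hJ⟩ := not_or.1 h
        obtain ⟨p, hp⟩ := not_forall.1 hI
        obtain ⟨hp, hp0⟩ := Classical.not_imp.1 hp
        obtain ⟨q, hq⟩ := not_forall.1 hJ
        obtain ⟨hq, hq0⟩ := Classical.not_imp.1 hq
        have h0 := hx (p * q) (Ideal.mul_mem_mul hp hq)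
        rw [map_mul] at h0
        exact (mul_ne_zero hp0 hq0) h0)

/-- The dimension of a Zariski closed set `Z`: the Krull dimension of its coordinate ring
`ℂ[σ] / I(Z)`. -/
def zariskiDim {σ : Type} (Z : Set (ZariskiSpace σ)) : WithBot ℕ∞ :=
  ringKrullDim (MvPolynomial σ ℂ ⧸ MvPolynomial.vanishingIdeal ℂ (K := ℂ) (σ := σ) Z)

/-- The left multiplication action of `SL_l(ℂ)` on `l × n` matrices, that is, the diagonal action
on `n`-tuples of columns of length `l`. A matrix is recorded as the family of its entries. -/
def act {l n : ℕ} (g : Matrix.SpecialLinearGroup (Fin l) ℂ) (A : Fin l × Fin n → ℂ) :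
    Fin l × Fin n → ℂ :=
  fun p => ((g : Matrix (Fin l) (Fin l) ℂ) * Matrix.of fun i j => A (i, j)) p.1 p.2

/-- The algebra `ℂ[M_{l,1}^n]^{SL_l(ℂ)}` of invariant polynomials, where
`(g • f)(A) = f (g⁻¹ • A)`. -/
def invariants (l n : ℕ) : Subalgebra ℂ (MvPolynomial (Fin l × Fin n) ℂ) where
  carrier := {f | ∀ (g : Matrix.SpecialLinearGroup (Fin l) ℂ) (A : Fin l × Fin n → ℂ),
    MvPolynomial.eval (act g⁻¹ A) f = MvPolynomial.eval A f}
  mul_mem' := fun hf hh g A => by rw [map_mul, map_mul, hf g A, hh g A]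
  add_mem' := fun hf hh g A => by rw [map_add, map_add, hf g A, hh g A]
  algebraMap_mem' := fun r g A => by
    rw [MvPolynomial.algebraMap_eq, MvPolynomial.eval_C, MvPolynomial.eval_C]

/-- The separating variety: the pairs of points of `M_{l,1}^n` that no invariant separates.
A pair is a point of the affine space with two blocks of `l * n` coordinates. -/
def separatingVariety (l n : ℕ) : Set (ZariskiSpace ((Fin l × Fin n) ⊕ (Fin l × Fin n))) :=
  {p | ∀ f ∈ invariants l n,
    MvPolynomial.eval (fun c => p (Sum.inl c)) f = MvPolynomial.eval (fun c => p (Sum.inr c)) f}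

end SepVar

end

noncomputable section

namespace SepVar

open MvPolynomial

/-! Write a pair as matrices (A, B). Maximal minors are invariants, so on the separating variety
those of A and B agree. If one minor is nonzero, Cramer's rule gives A = PR and B = QR with det P =
det Q; if all vanish, both matrices have dependent rows. Conversely, when det P = det Q ≠ 0 the two
matrices lie in one orbit, and on a degenerate matrix every invariant takes its value at 0. So the
variety is E ∪ F, with E = `commonFactorPairs` and F = `degeneratePairs`
(`separatingVariety_eq_union`); no generators of the invariant ring are needed.

E and F are polynomial images of affine spaces, hence irreducible. Each dimension is found from a
set of coordinates that can be prescribed generically (lower bound, `card_le_zariskiDim`) and from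
which all others follow by exact division (upper bound, `zariskiDim_le_card`).

On E the stacked matrix (A; B) has rank at most l, whereas on F it can reach l + 1 once l ≥ 3 and n
≥ l + 1; a maximal minor of A vanishes on F but not on E. So the closures are the two components,
and that minor makes the intersection smaller than E. For l = 3 an explicit family attains the
bound. For l = 2 two matrices of rank at most 1 always share a factor R, so F lies in E. -/

/-! ### Krull dimension and transcendence degree. -/

lemma ringKrullDim_le_of_isIntegral (R S : Type*) [CommRing R] [CommRing S] [Algebra R S]
    [Algebra.IsIntegral R S] : ringKrullDim S ≤ ringKrullDim R :=
  Order.krullDim_le_of_strictMono (PrimeSpectrum.comap (algebraMap R S))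
    fun _ _ h => Ideal.IsIntegral.comap_lt_comap h

lemma ringKrullDim_eq_of_isIntegral_of_injective (R S : Type*) [CommRing R] [CommRing S]
    [Algebra R S] [Algebra.IsIntegral R S] (hinj : Function.Injective (algebraMap R S)) :
    ringKrullDim S = ringKrullDim R := by
  refine le_antisymm (ringKrullDim_le_of_isIntegral R S) ?_
  refine iSup_le fun q => ?_
  -- Lying over for the top of the chain; going up below then lifts the chain itself with its
  -- length.
  obtain ⟨P, -, hP, hPq⟩ := Ideal.exists_ideal_over_prime_of_isIntegral q.head.asIdeal (⊥ : Ideal S)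
    (by rw [← RingHom.ker_eq_comap_bot, (RingHom.injective_iff_ker_eq_bot _).1 hinj]; exact bot_le)
  have : P.LiesOver q.head.asIdeal := ⟨hPq.symm⟩
  obtain ⟨L, hL, -⟩ := Ideal.exists_ltSeries_of_hasGoingUp q P
  rw [← hL]
  exact le_iSup (fun p : LTSeries (PrimeSpectrum S) => ((p.length : ℕ∞) : WithBot ℕ∞)) L

/-- The Krull dimension of a finitely generated domain over a field is its transcendence degree. -/
lemma exists_ringKrullDim_eq_trdeg {k R : Type} [Field k] [CommRing R] [IsDomain R] [Algebra k R]
    [Algebra.FiniteType k R] :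
    ∃ s : ℕ, ringKrullDim R = s ∧ Algebra.trdeg k R = s := by
  -- Noether normalization: s variables compute both invariants.
  obtain ⟨s, g, hg, hint⟩ := exists_integral_inj_algHom_of_fg k R
  refine ⟨s, ?_⟩
  algebraize [g.toRingHom]
  have hinj : Function.Injective (algebraMap (MvPolynomial (Fin s) k) R) := hg
  have : FaithfulSMul (MvPolynomial (Fin s) k) R := (faithfulSMul_iff_algebraMap_injective _ _).2 hg
  constructor
  · rw [ringKrullDim_eq_of_isIntegral_of_injective _ R hinj,
      MvPolynomial.ringKrullDim_of_isNoetherianRing, ringKrullDim_eq_zero_of_field]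
    simp
  · have := trdeg_add_eq k (MvPolynomial (Fin s) k) (A := R)
    rw [← this, MvPolynomial.trdeg_of_isDomain, trdeg_eq_zero]
    simp

/-- Since `R` need not be a domain, one passes to `R ⧸ P` for a prime `P` contracting to 0 in the
polynomial ring; the elements stay independent there, and transcendence degree applies. -/
lemma card_le_ringKrullDim {k R τ : Type} [Field k] [CommRing R] [Algebra k R]
    [Algebra.FiniteType k R] [Fintype τ] (x : τ → R) (hx : AlgebraicIndependent k x) :
    (Fintype.card τ : WithBot ℕ∞) ≤ ringKrullDim R := by
  obtain ⟨P, hP, hP0⟩ := Ideal.exists_comap_eq_of_mem_minimalPrimes_of_injective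
    (f := (aeval x : MvPolynomial τ k →ₐ[k] R).toRingHom) hx ⊥ (by
      rw [IsDomain.minimalPrimes_eq_singleton_bot]; rfl)
  have hx' : AlgebraicIndependent k (fun t => Ideal.Quotient.mkₐ k P (x t)) := by
    rw [algebraicIndependent_iff]
    intro p hp
    have : aeval x p ∈ P := by
      rw [← Ideal.Quotient.eq_zero_iff_mem, ← hp]
      exact (comp_aeval_apply (φ := Ideal.Quotient.mkₐ k P) (f := x) p)
    have : p ∈ (⊥ : Ideal (MvPolynomial τ k)) := hP0 ▸ this
    simpa using this
  obtain ⟨s, hs, ht⟩ := exists_ringKrullDim_eq_trdeg (k := k) (R := R ⧸ P)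
  have h1 := hx'.cardinalMk_le_trdeg
  rw [ht, Cardinal.mk_fintype, Nat.cast_le] at h1
  calc (Fintype.card τ : WithBot ℕ∞) ≤ s := by exact_mod_cast h1
    _ = ringKrullDim (R ⧸ P) := hs.symm
    _ ≤ ringKrullDim R := ringKrullDim_quotient_le P

/-- A finitely generated domain has dimension at most `m` if it is contained in every subalgebra
that contains `m` given elements and is closed under exact division. -/
lemma ringKrullDim_le_card {k R τ : Type} [Field k] [CommRing R] [IsDomain R] [Algebra k R]
    [Algebra.FiniteType k R] [Fintype τ] (x : τ → R)
    (hx : ∀ M : Subalgebra k R, (∀ t, x t ∈ M) →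
      (∀ q y, q ∈ M → q ≠ 0 → q * y ∈ M → y ∈ M) → M = ⊤) :
    ringKrullDim R ≤ Fintype.card τ := by
  -- The test subalgebra consists of the elements algebraic over the one generated by the `x t`; in
  -- a domain it is closed under exact division.
  have h := hx ((Subalgebra.algebraicClosure (Algebra.adjoin k (Set.range x)) R).restrictScalars k)
    (fun t => isAlgebraic_algebraMap
      (⟨x t, Algebra.subset_adjoin ⟨t, rfl⟩⟩ : Algebra.adjoin k (Set.range x)))
    (fun q y hq h0 hqy => IsAlgebraic.of_mul (mem_nonZeroDivisors_of_ne_zero h0) hq hqy)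
  have : Algebra.IsAlgebraic (Algebra.adjoin k (Set.range x)) R := ⟨fun y => by
    have : y ∈ (⊤ : Subalgebra k R) := trivial
    rw [← h] at this
    exact this⟩
  obtain ⟨s, hs, ht⟩ := exists_ringKrullDim_eq_trdeg (k := k) (R := R)
  have h1 := (Algebra.IsAlgebraic.trdeg_le_cardinalMk k (Set.range x)).trans Cardinal.mk_range_le
  rw [ht, Cardinal.mk_fintype, Nat.cast_le] at h1
  rw [hs]
  exact_mod_cast h1

/-! ### Polynomial functions, Zariski topology and dimension. -/

section

/-- Polynomial functions on affine space. -/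
def IsPoly {σ : Type} (f : (σ → ℂ) → ℂ) : Prop :=
  ∃ p : MvPolynomial σ ℂ, ∀ x, eval x p = f x

namespace IsPoly

variable {σ : Type} {f g : (σ → ℂ) → ℂ}

lemma const (c : ℂ) : IsPoly (fun _ : σ → ℂ => c) := ⟨C c, fun _ => eval_C c⟩

lemma coord (s : σ) : IsPoly (fun x : σ → ℂ => x s) := ⟨X s, fun _ => eval_X s⟩

lemma add (hf : IsPoly f) (hg : IsPoly g) : IsPoly (fun x => f x + g x) := by
  obtain ⟨p, hp⟩ := hf
  obtain ⟨q, hq⟩ := hg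
  exact ⟨p + q, fun x => by rw [map_add, hp, hq]⟩

lemma mul (hf : IsPoly f) (hg : IsPoly g) : IsPoly (fun x => f x * g x) := by
  obtain ⟨p, hp⟩ := hf
  obtain ⟨q, hq⟩ := hg
  exact ⟨p * q, fun x => by rw [map_mul, hp, hq]⟩

lemma sum {ι : Type*} (s : Finset ι) {F : ι → (σ → ℂ) → ℂ} (h : ∀ i, IsPoly (F i)) :
    IsPoly (fun x => ∑ i ∈ s, F i x) := by
  choose p hp using h
  exact ⟨∑ i ∈ s, p i, fun x => by rw [map_sum]; exact Finset.sum_congr rfl fun i _ => hp i x⟩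

lemma prod {ι : Type*} (s : Finset ι) {F : ι → (σ → ℂ) → ℂ} (h : ∀ i, IsPoly (F i)) :
    IsPoly (fun x => ∏ i ∈ s, F i x) := by
  choose p hp using h
  exact ⟨∏ i ∈ s, p i, fun x => by rw [map_prod]; exact Finset.prod_congr rfl fun i _ => hp i x⟩

lemma matrix_mul {m n o : Type*} [Fintype n] {A : (σ → ℂ) → Matrix m n ℂ}
    {B : (σ → ℂ) → Matrix n o ℂ} (hA : ∀ i j, IsPoly fun x => A x i j)
    (hB : ∀ i j, IsPoly fun x => B x i j) (i : m) (j : o) : IsPoly fun x => (A x * B x) i j := by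
  simp only [Matrix.mul_apply]
  exact sum _ fun k => (hA i k).mul (hB k j)

lemma det {n : Type*} [Fintype n] [DecidableEq n] {A : (σ → ℂ) → Matrix n n ℂ}
    (hA : ∀ i j, IsPoly fun x => A x i j) : IsPoly fun x => (A x).det := by
  simp only [Matrix.det_apply']
  exact sum _ fun k => (const _).mul (prod _ fun i => hA _ _)

end IsPoly

section Topology

variable {σ τ : Type}

lemma isClosed_iff_zeroLocus {Z : Set (ZariskiSpace σ)} :
    IsClosed Z ↔ ∃ I : Ideal (MvPolynomial σ ℂ), Z = zeroLocus ℂ I := by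
  rw [← isOpen_compl_iff]
  change Zᶜᶜ ∈ {Z : Set (σ → ℂ) | ∃ I : Ideal (MvPolynomial σ ℂ), Z = zeroLocus ℂ I} ↔ _
  rw [compl_compl]
  rfl

lemma isClosed_setOf_forall_eval_eq_zero (s : Set (MvPolynomial σ ℂ)) :
    IsClosed {x : ZariskiSpace σ | ∀ p ∈ s, eval (x : σ → ℂ) p = 0} := by
  rw [isClosed_iff_zeroLocus]
  exact ⟨Ideal.span s, by rw [zeroLocus_span]; rfl⟩

lemma IsPoly.isClosed {f : (σ → ℂ) → ℂ} (hf : IsPoly f) :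
    IsClosed {x : ZariskiSpace σ | f x = 0} := by
  obtain ⟨p, hp⟩ := hf
  convert! isClosed_setOf_forall_eval_eq_zero {p} using 1
  exact Set.ext fun x => ⟨fun h q hq => by rw [Set.mem_singleton_iff.1 hq]; exact (hp x).trans h,
    fun h => (hp x).symm.trans (h p rfl)⟩

lemma isClosed_iff_poly {Z : Set (ZariskiSpace σ)} :
    IsClosed Z ↔ ∃ s : Set (MvPolynomial σ ℂ), Z = {x | ∀ p ∈ s, eval (x : σ → ℂ) p = 0} := by
  constructor
  · rw [isClosed_iff_zeroLocus]
    rintro ⟨I, rfl⟩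
    exact ⟨I, rfl⟩
  · rintro ⟨s, rfl⟩
    exact isClosed_setOf_forall_eval_eq_zero s

lemma eq_zero_on_closure {f : (σ → ℂ) → ℂ} (hf : IsPoly f) {Z : Set (ZariskiSpace σ)}
    (h : ∀ x ∈ Z, f x = 0) : ∀ x ∈ closure Z, f x = 0 :=
  fun _ hx => closure_minimal (t := {x : ZariskiSpace σ | f x = 0}) h hf.isClosed hx

lemma continuous_of_isPoly {φ : ZariskiSpace τ → ZariskiSpace σ}
    (h : ∀ s, IsPoly fun x : τ → ℂ => φ x s) : Continuous φ := by
  choose F hF using h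
  refine continuous_iff_isClosed.2 fun Z hZ => ?_
  obtain ⟨s, rfl⟩ := isClosed_iff_poly.1 hZ
  convert! isClosed_setOf_forall_eval_eq_zero (bind₁ F '' s) using 1
  have key : ∀ (x : τ → ℂ) (p : MvPolynomial σ ℂ),
      eval x (bind₁ F p) = eval (φ x : σ → ℂ) p := fun x p =>
    (aeval_bind₁ x F p).trans (congrArg (fun y : σ → ℂ => eval y p) (funext fun i => hF i x))
  refine Set.ext fun x => ⟨?_, fun h p hp => (key x p).symm.trans (h _ ⟨p, hp, rfl⟩)⟩
  rintro h _ ⟨p, hp, rfl⟩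
  exact (key x p).trans (h p hp)

lemma isIrreducible_univ_zariskiSpace : IsIrreducible (Set.univ : Set (ZariskiSpace σ)) := by
  refine ⟨⟨(fun _ => 0 : σ → ℂ), trivial⟩, ?_⟩
  rw [isPreirreducible_iff_isClosed_union_isClosed]
  intro Z₁ Z₂ h₁ h₂ h
  obtain ⟨s₁, rfl⟩ := isClosed_iff_poly.1 h₁
  obtain ⟨s₂, rfl⟩ := isClosed_iff_poly.1 h₂
  by_contra hc
  obtain ⟨hc₁, hc₂⟩ := not_or.1 hc
  obtain ⟨x, -, hx⟩ := Set.not_subset.1 hc₁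
  obtain ⟨y, -, hy⟩ := Set.not_subset.1 hc₂
  obtain ⟨p, hp⟩ := not_forall.1 hx
  obtain ⟨hp, hpx⟩ := Classical.not_imp.1 hp
  obtain ⟨q, hq⟩ := not_forall.1 hy
  obtain ⟨hq, hqy⟩ := Classical.not_imp.1 hq
  have hp0 : p ≠ 0 := by rintro rfl; exact hpx (map_zero _)
  have hq0 : q ≠ 0 := by rintro rfl; exact hqy (map_zero _)
  refine mul_ne_zero hp0 hq0 (MvPolynomial.funext fun z => ?_)
  rw [map_mul, map_zero]
  rcases h (Set.mem_univ z) with hz | hz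
  · rw [hz p hp, zero_mul]
  · rw [hz q hq, mul_zero]

lemma isIrreducible_range_of_isPoly {φ : ZariskiSpace τ → ZariskiSpace σ}
    (h : ∀ s, IsPoly fun x : τ → ℂ => φ x s) : IsIrreducible (Set.range φ) := by
  rw [← Set.image_univ]
  exact isIrreducible_univ_zariskiSpace.image φ (continuous_of_isPoly h).continuousOn

/-- The ideal of polynomials vanishing on `Z`. -/
abbrev idealOf (Z : Set (ZariskiSpace σ)) : Ideal (MvPolynomial σ ℂ) :=
  MvPolynomial.vanishingIdeal ℂ (K := ℂ) (σ := σ) Z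

lemma mem_idealOf {Z : Set (ZariskiSpace σ)} {p : MvPolynomial σ ℂ} :
    p ∈ idealOf Z ↔ ∀ x ∈ Z, eval (x : σ → ℂ) p = 0 := Iff.rfl

lemma idealOf_closure (Z : Set (ZariskiSpace σ)) :
    idealOf (closure Z : Set (ZariskiSpace σ)) = idealOf Z :=
  le_antisymm (fun _ hp x hx => hp x (subset_closure (X := ZariskiSpace σ) hx))
    fun p hp x hx => eq_zero_on_closure (f := fun x => eval x p) ⟨p, fun _ => rfl⟩ (Z := Z)
      hp x hx

lemma zariskiDim_closure (Z : Set (ZariskiSpace σ)) : zariskiDim (closure Z) = zariskiDim Z := by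
  change ringKrullDim (_ ⧸ idealOf (closure Z)) = ringKrullDim (_ ⧸ idealOf Z)
  rw [idealOf_closure]

lemma idealOf_isPrime {Z : Set (ZariskiSpace σ)} (hZ : IsIrreducible Z) :
    (idealOf Z).IsPrime := by
  refine ⟨fun h => ?_, fun {p q} hpq => ?_⟩
  · obtain ⟨x, hx⟩ := hZ.1
    have := mem_idealOf.1 ((Ideal.eq_top_iff_one _).1 h) x hx
    simp at this
  · have := isPreirreducible_iff_isClosed_union_isClosed.1 hZ.2
      {x | eval (x : σ → ℂ) p = 0} {x | eval (x : σ → ℂ) q = 0}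
      (IsPoly.isClosed ⟨p, fun _ => rfl⟩) (IsPoly.isClosed ⟨q, fun _ => rfl⟩)
      fun x hx => by
        have := mem_idealOf.1 hpq x hx
        rwa [map_mul, mul_eq_zero] at this
    exact this

/-- If generic values of the coordinates `ι t` are taken on `Z`, then `Z` has dimension at least
the number of these coordinates. -/
lemma card_le_zariskiDim [Finite σ] [Fintype τ] {Z : Set (ZariskiSpace σ)} {ι : τ → σ}
    (hι : Function.Injective ι) {f : (σ → ℂ) → ℂ} (hf : IsPoly f) {x₀ : σ → ℂ} (hx₀ : f x₀ ≠ 0)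
    (h : ∀ x : σ → ℂ, f x ≠ 0 → ∃ z ∈ Z, ∀ t, z (ι t) = x (ι t)) :
    (Fintype.card τ : WithBot ℕ∞) ≤ zariskiDim Z := by
  obtain ⟨q, hq⟩ := hf
  have hq0 : q ≠ 0 := by rintro rfl; exact hx₀ (by rw [← hq, map_zero])
  refine card_le_ringKrullDim (k := ℂ) (fun t => Ideal.Quotient.mkₐ ℂ (idealOf Z) (X (ι t))) ?_
  rw [algebraicIndependent_iff]
  intro p hp
  by_contra hp0
  have hmem : rename ι p ∈ idealOf Z := by
    have h1 : Ideal.Quotient.mkₐ ℂ (idealOf Z) (aeval (fun t => X (ι t)) p) = 0 :=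
      (comp_aeval_apply (φ := Ideal.Quotient.mkₐ ℂ (idealOf Z)) (f := fun t => X (ι t)) p).trans hp
    exact Ideal.Quotient.eq_zero_iff_mem.1 (by rw [rename_eq_aeval]; exact h1)
  -- A relation between the chosen coordinates on `Z`, multiplied by `q`, would vanish everywhere:
  -- where `q` is nonzero these coordinates are realised by a point of `Z`.
  refine mul_ne_zero ((rename_injective ι hι).ne_iff' (map_zero _) |>.2 hp0) hq0
    (MvPolynomial.funext fun x => ?_)
  rw [map_mul, map_zero]
  by_cases hx : f x = 0
  · rw [hq, hx, mul_zero]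
  · obtain ⟨z, hz, hzx⟩ := h x hx
    have h1 : eval (fun t => z (ι t)) p = 0 :=
      (eval_rename ι z p).symm.trans (mem_idealOf.1 hmem z hz)
    have h2 : x ∘ ι = fun t => z (ι t) := funext fun t => (hzx t).symm
    rw [eval_rename, h2, h1, zero_mul]

/-- An irreducible set has dimension at most the number of coordinates `ι t`, if all coordinate
functions are obtained from these by polynomial operations and exact division on `Z`. -/
lemma zariskiDim_le_card [Finite σ] [Fintype τ] {Z : Set (ZariskiSpace σ)} (hZ : IsIrreducible Z)
    (ι : τ → σ)
    (h : ∀ M : Subalgebra ℂ (MvPolynomial σ ℂ), (∀ t, X (ι t) ∈ M) → (∀ p ∈ idealOf Z, p ∈ M) →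
      (∀ q y, q ∈ M → q ∉ idealOf Z → q * y ∈ M → y ∈ M) → ∀ s, X s ∈ M) :
    zariskiDim Z ≤ Fintype.card τ := by
  have := idealOf_isPrime hZ
  refine ringKrullDim_le_card (k := ℂ) (fun t => Ideal.Quotient.mkₐ ℂ (idealOf Z) (X (ι t))) ?_
  intro M hM hdiv
  have h1 := h (M.comap (Ideal.Quotient.mkₐ ℂ (idealOf Z))) hM
    (fun p hp => by
      have : Ideal.Quotient.mkₐ ℂ (idealOf Z) p = 0 := Ideal.Quotient.eq_zero_iff_mem.2 hp
      rw [Subalgebra.mem_comap, this]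
      exact M.zero_mem)
    (fun q y hq hq0 hqy => hdiv _ _ hq (fun h => hq0 (Ideal.Quotient.eq_zero_iff_mem.1 h))
      (by rw [← map_mul]; exact hqy))
  have h2 : M.comap (Ideal.Quotient.mkₐ ℂ (idealOf Z)) = ⊤ := by
    rw [eq_top_iff, ← adjoin_range_X, Algebra.adjoin_le_iff]
    rintro _ ⟨s, rfl⟩
    exact h1 s
  refine eq_top_iff.2 fun y _ => ?_
  obtain ⟨p, rfl⟩ := Ideal.Quotient.mkₐ_surjective ℂ (idealOf Z) y
  have : p ∈ M.comap (Ideal.Quotient.mkₐ ℂ (idealOf Z)) := h2 ▸ trivial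
  exact this

/-- The class of `f` is a nonzerodivisor in the domain of functions on `Z` and dies in the quotient
belonging to `W`, so the dimension drops. -/
lemma zariskiDim_add_one_le {Z W : Set (ZariskiSpace σ)} (hZ : IsIrreducible Z) (hWZ : W ⊆ Z)
    {f : (σ → ℂ) → ℂ} (hf : IsPoly f) (hW : ∀ x ∈ W, f x = 0) {z : ZariskiSpace σ} (hz : z ∈ Z)
    (hfz : f z ≠ 0) : zariskiDim W + 1 ≤ zariskiDim Z := by
  obtain ⟨p, hp⟩ := hf
  have := idealOf_isPrime hZ
  have hle : idealOf Z ≤ idealOf W := vanishingIdeal_anti_mono hWZ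
  refine ringKrullDim_succ_le_of_surjective (Ideal.Quotient.factor hle)
    (Ideal.Quotient.factor_surjective hle) (r := Ideal.Quotient.mk _ p)
    (mem_nonZeroDivisors_of_ne_zero fun h => ?_) ?_
  · exact hfz ((hp z).symm.trans (mem_idealOf.1 (Ideal.Quotient.eq_zero_iff_mem.1 h) z hz))
  · rw [Ideal.Quotient.factor_mk]
    exact Ideal.Quotient.eq_zero_iff_mem.2 fun x hx => (hp x).trans (hW x hx)

end Topology

/-- A subspace covered by two incomparable irreducible closed sets has these as its irreducible
components. -/
lemma irreducibleComponents_subtype_eq_pair {X : Type*} [TopologicalSpace X] {S E F : Set X}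
    (hE : IsIrreducible E) (hF : IsIrreducible F) (hEc : IsClosed E) (hFc : IsClosed F)
    (hS : S = E ∪ F) (hEF : ¬ E ⊆ F) (hFE : ¬ F ⊆ E) :
    irreducibleComponents S =
      {((↑) : S → X) ⁻¹' E, ((↑) : S → X) ⁻¹' F} := by
  have key : ∀ T : Set X, T ⊆ S → IsIrreducible T → IsIrreducible (((↑) : S → X) ⁻¹' T) := by
    intro T hTS hT
    refine ⟨?_, ?_⟩
    · obtain ⟨x, hx⟩ := hT.1
      exact ⟨⟨x, hTS hx⟩, hx⟩
    · rintro _ _ ⟨U, hU, rfl⟩ ⟨V, hV, rfl⟩ ⟨x, hx, hxU⟩ ⟨y, hy, hyV⟩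
      obtain ⟨z, hz, hzUV⟩ := hT.2 U V hU hV ⟨x, hx, hxU⟩ ⟨y, hy, hyV⟩
      exact ⟨⟨z, hTS hz⟩, hz, hzUV⟩
  have hES : E ⊆ S := hS ▸ Set.subset_union_left
  have hFS : F ⊆ S := hS ▸ Set.subset_union_right
  have cover : ∀ T : Set S, IsIrreducible T →
      T ⊆ ((↑) : S → X) ⁻¹' E ∨ T ⊆ ((↑) : S → X) ⁻¹' F := fun T hT =>
    isPreirreducible_iff_isClosed_union_isClosed.1 hT.2 _ _
      (hEc.preimage continuous_subtype_val) (hFc.preimage continuous_subtype_val)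
      fun x _ => (hS ▸ x.2 : (x : X) ∈ E ∪ F)
  have incl : ∀ T T' : Set X, T ⊆ S → ((↑) : S → X) ⁻¹' T ⊆ ((↑) : S → X) ⁻¹' T' → T ⊆ T' :=
    fun T T' hT h x hx => h (show (⟨x, hT hx⟩ : S) ∈ _ from hx)
  ext T
  constructor
  · intro hT
    rcases cover T hT.1 with h | h
    · exact Or.inl (h.antisymm (hT.2 (key E hES hE) h))
    · exact Or.inr (h.antisymm (hT.2 (key F hFS hF) h))
  · rintro (rfl | rfl)
    · refine ⟨key E hES hE, fun T' hT' h => ?_⟩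
      rcases cover T' hT' with h' | h'
      · exact h'
      · exact absurd (incl E F hES (h.trans h')) hEF
    · refine ⟨key F hFS hF, fun T' hT' h => ?_⟩
      rcases cover T' hT' with h' | h'
      · exact absurd (incl F E hFS (h.trans h')) hFE
      · exact h'

end

/-! ### Degenerate matrices and maximal minors. -/

section

section LinearAlgebra

variable {l n : Type} [Fintype l]

/-- A matrix is degenerate if its rows are linearly dependent. -/
def Degenerate (A : Matrix l n ℂ) : Prop := ∃ v : l → ℂ, v ≠ 0 ∧ Matrix.vecMul v A = 0

lemma Degenerate.exists_eq_one {A : Matrix l n ℂ} (hA : Degenerate A) :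
    ∃ (v : l → ℂ) (i : l), v i = 1 ∧ Matrix.vecMul v A = 0 := by
  obtain ⟨v, hv, h⟩ := hA
  obtain ⟨i, hi⟩ := Function.ne_iff.1 hv
  refine ⟨(v i)⁻¹ • v, i, ?_, ?_⟩
  · simpa using inv_mul_cancel₀ hi
  · rw [Matrix.smul_vecMul, h, smul_zero]

lemma degenerate_mul {m : Type} [Fintype m] {P : Matrix l m ℂ} (hP : Degenerate P)
    (R : Matrix m n ℂ) : Degenerate (P * R) := by
  obtain ⟨v, hv, h⟩ := hP
  exact ⟨v, hv, by rw [← Matrix.vecMul_vecMul, h, Matrix.zero_vecMul]⟩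

variable [DecidableEq l]

lemma degenerate_iff_det_eq_zero {P : Matrix l l ℂ} : Degenerate P ↔ P.det = 0 :=
  Matrix.exists_vecMul_eq_zero_iff

/-- A degenerate matrix is fixed by a projection whose kernel is a coordinate axis. -/
lemma Degenerate.exists_projection {A : Matrix l n ℂ} (hA : Degenerate A) :
    ∃ (P : Matrix l l ℂ) (i : l), P.det = 0 ∧ P * A = A ∧ ∀ a, P a i = 0 := by
  obtain ⟨v, i, hi, h⟩ := hA.exists_eq_one
  refine ⟨1 - Matrix.vecMulVec (Pi.single i 1) v, i, ?_, ?_, ?_⟩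
  · refine degenerate_iff_det_eq_zero.1 ⟨v, fun h => by simp [h] at hi, ?_⟩
    rw [Matrix.vecMul_sub, Matrix.vecMul_one, Matrix.vecMul_vecMulVec]
    simp [hi]
  · rw [Matrix.sub_mul, Matrix.one_mul, Matrix.vecMulVec_mul, h]
    ext a j
    simp [Matrix.vecMulVec_apply]
  · intro a
    rw [Matrix.sub_apply, Matrix.vecMulVec_apply, hi, mul_one, Matrix.one_apply, Pi.single_apply,
      sub_self]

/-- Any degenerate matrix `A` factors through the diagonal matrix `diag(1, …, 0, …, 1)`. -/
lemma Degenerate.exists_eq_mul_diagonal_mul {A : Matrix l n ℂ} (hA : Degenerate A) (i₀ : l) :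
    ∃ (U : Matrix l l ℂ) (V : Matrix l n ℂ),
      A = U * Matrix.diagonal (Function.update 1 i₀ 0) * V := by
  obtain ⟨P, i, -, hPA, hPi⟩ := hA.exists_projection
  -- Swapping indices moves the zero column of `P` to position `i₀`, where the diagonal factor acts
  -- harmlessly.
  let e : l ≃ l := Equiv.swap i i₀
  refine ⟨P.submatrix id e, A.submatrix e id, ?_⟩
  have hP : P.submatrix id e * Matrix.diagonal (Function.update 1 i₀ 0) = P.submatrix id e := by
    ext a b
    rw [Matrix.mul_diagonal]
    by_cases hb : b = i₀
    · subst hb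
      simp [e, hPi]
    · simp [hb]
  rw [hP, Matrix.submatrix_mul_equiv, hPA, Matrix.submatrix_id_id]

/-- If the columns did not span, a functional killing them would be a row relation; so some columns
form a basis. -/
lemma exists_det_submatrix_ne_zero [Fintype n] {A : Matrix l n ℂ} (hA : ¬ Degenerate A) :
    ∃ f : l → n, (A.submatrix id f).det ≠ 0 := by
  have hspan : Submodule.span ℂ (Set.range A.col) = ⊤ := by
    by_contra h
    obtain ⟨φ, hφ, hle⟩ := Submodule.exists_le_ker_of_lt_top _ (lt_top_iff_ne_top.2 h)
    have hφ' : ∀ w : l → ℂ, φ w = (fun i => φ (Pi.single i 1)) ⬝ᵥ w := fun w => by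
      conv_lhs => rw [← Finset.univ_sum_single w]
      rw [map_sum]
      refine Finset.sum_congr rfl fun i _ => ?_
      have : Pi.single i (w i) = w i • (Pi.single i 1 : l → ℂ) := by
        rw [← Pi.single_smul, smul_eq_mul, mul_one]
      rw [this, map_smul, smul_eq_mul, mul_comm]
    refine hA ⟨fun i => φ (Pi.single i 1), fun h0 => hφ ?_, ?_⟩
    · ext w
      simpa using congrFun h0 w
    · ext j
      have : φ (A.col j) = 0 := hle (Submodule.subset_span ⟨j, rfl⟩)
      rw [hφ'] at this
      exact this
  obtain ⟨κ, a, -, hs, hli⟩ := exists_linearIndependent' ℂ A.col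
  rw [hspan] at hs
  let b := Module.Basis.mk hli hs.ge
  have := Module.Finite.finite_basis b
  have := Fintype.ofFinite κ
  let e : l ≃ κ := (Pi.basisFun ℂ l).indexEquiv b
  refine ⟨a ∘ e, ?_⟩
  have h2 := (hli.comp e e.injective)
  have h3 := (Matrix.linearIndependent_cols_iff_isUnit (A := A.submatrix id (a ∘ e))).1 h2
  exact ((Matrix.isUnit_iff_isUnit_det _).1 h3).ne_zero

lemma Degenerate.det_submatrix_eq_zero {A : Matrix l n ℂ} (hA : Degenerate A) (f : l → n) :
    (A.submatrix id f).det = 0 := by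
  obtain ⟨v, hv, h⟩ := hA
  refine degenerate_iff_det_eq_zero.1 ⟨v, hv, ?_⟩
  ext j
  exact congrFun h (f j)

/-- Cramer's rule: a nonsingular maximal minor and its neighbours determine the matrix up to left
multiplication. -/
lemma inv_submatrix_mul_eq {A B : Matrix l n ℂ}
    (h : ∀ f : l → n, (A.submatrix id f).det = (B.submatrix id f).det) (f : l → n) :
    (A.submatrix id f)⁻¹ * A = (B.submatrix id f)⁻¹ * B := by
  -- Each entry is a quotient of maximal minors, the numerator having column `j` in position `k`.
  have key : ∀ (C : Matrix l n ℂ) (k : l) (j : n), ((C.submatrix id f)⁻¹ * C) k j =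
      Ring.inverse (C.submatrix id f).det * (C.submatrix id (Function.update f k j)).det := by
    intro C k j
    have h1 : C.submatrix id (Function.update f k j) =
        (C.submatrix id f).updateCol k (fun i => C i j) := by
      ext a b
      by_cases hb : b = k
      · subst hb; simp
      · simp [hb]
    rw [h1, ← Matrix.cramer_apply, Matrix.cramer_eq_adjugate_mulVec, Matrix.inv_def,
      Matrix.smul_mul, Matrix.smul_apply, smul_eq_mul]
    rfl
  ext k j
  rw [key, key, h, h]

end LinearAlgebra

/-! ### Decomposition of the separating variety. -/

/-- Pairs of `l × n` matrices, with the Zariski topology. -/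
abbrev PairSpace (l n : ℕ) : Type := ZariskiSpace ((Fin l × Fin n) ⊕ (Fin l × Fin n))

variable {l n : ℕ}

/-- The first matrix of a pair. -/
def fstMat (p : PairSpace l n) : Matrix (Fin l) (Fin n) ℂ := Matrix.of fun i j => p (Sum.inl (i, j))

/-- The second matrix of a pair. -/
def sndMat (p : PairSpace l n) : Matrix (Fin l) (Fin n) ℂ := Matrix.of fun i j => p (Sum.inr (i, j))

/-- The point of `PairSpace l n` with the given matrices. -/
def pair (A B : Matrix (Fin l) (Fin n) ℂ) : PairSpace l n :=
  Sum.elim (fun c => A c.1 c.2) (fun c => B c.1 c.2)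

@[simp] lemma fstMat_pair (A B : Matrix (Fin l) (Fin n) ℂ) : fstMat (pair A B) = A := rfl

@[simp] lemma sndMat_pair (A B : Matrix (Fin l) (Fin n) ℂ) : sndMat (pair A B) = B := rfl

lemma pair_fstMat_sndMat (p : PairSpace l n) : pair (fstMat p) (sndMat p) = p := by
  funext c
  rcases c with c | c <;> rfl

/-- The pairs `(P R, Q R)` with `det P = det Q`. -/
def commonFactorPairs (l n : ℕ) : Set (PairSpace l n) :=
  {p | ∃ (P Q : Matrix (Fin l) (Fin l) ℂ) (R : Matrix (Fin l) (Fin n) ℂ),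
    P.det = Q.det ∧ p = pair (P * R) (Q * R)}

/-- The pairs of degenerate matrices. -/
def degeneratePairs (l n : ℕ) : Set (PairSpace l n) :=
  {p | Degenerate (fstMat p) ∧ Degenerate (sndMat p)}

/-- The entries of a matrix as a point of affine space. -/
def entries (A : Matrix (Fin l) (Fin n) ℂ) : Fin l × Fin n → ℂ := fun c => A c.1 c.2

lemma eval_mul_of_mem_invariants {f : MvPolynomial (Fin l × Fin n) ℂ} (hf : f ∈ invariants l n)
    {g : Matrix (Fin l) (Fin l) ℂ} (hg : g.det = 1) (A : Matrix (Fin l) (Fin n) ℂ) :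
    eval (entries (g * A)) f = eval (entries A) f := by
  let g' : Matrix.SpecialLinearGroup (Fin l) ℂ := ⟨g, hg⟩
  have := hf g'⁻¹ (entries A)
  rw [inv_inv g'] at this
  exact this

/-- Scaling by `t` can be corrected to determinant 1 by a rank-one change invisible to `A`, because
`v` annihilates `A`. So `t • A` lies in the orbit of `A`. -/
lemma eval_smul_of_degenerate {f : MvPolynomial (Fin l × Fin n) ℂ} (hf : f ∈ invariants l n)
    {A : Matrix (Fin l) (Fin n) ℂ} (hA : Degenerate A) {t : ℂ} (ht : t ≠ 0) :
    eval (entries (t • A)) f = eval (entries A) f := by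
  obtain ⟨v, i, hi, h⟩ := hA.exists_eq_one
  -- With `v i = 1` the rank-one factor has determinant `(t ^ l)⁻¹`, which cancels the `t ^ l` from
  -- scaling.
  let u : Fin l → ℂ := ((t ^ l)⁻¹ - 1) • Pi.single i 1
  let g : Matrix (Fin l) (Fin l) ℂ :=
    t • (1 + Matrix.replicateCol Unit u * Matrix.replicateRow Unit v)
  have hg : g.det = 1 := by
    rw [Matrix.det_smul, Matrix.det_one_add_replicateCol_mul_replicateRow, Fintype.card_fin]
    simp [u, hi, ht]
  have hgA : g * A = t • A := by
    have : Matrix.replicateRow Unit v * A = 0 := by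
      ext a j
      exact congrFun h j
    rw [Matrix.smul_mul, Matrix.add_mul, Matrix.one_mul, Matrix.mul_assoc, this, Matrix.mul_zero,
      add_zero]
  rw [← hgA]
  exact eval_mul_of_mem_invariants hf hg A

/-- Let `t` tend to 0 in the Euclidean topology: the value is constant for `t ≠ 0`, hence equals the
value at the origin. -/
lemma eval_of_degenerate {f : MvPolynomial (Fin l × Fin n) ℂ} (hf : f ∈ invariants l n)
    {A : Matrix (Fin l) (Fin n) ℂ} (hA : Degenerate A) :
    eval (entries A) f = eval 0 f := by
  have hcont : Continuous fun t : ℂ => eval (entries (t • A)) f := by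
    refine (MvPolynomial.continuous_eval f).comp (continuous_pi fun c => ?_)
    exact continuous_id.mul continuous_const
  have heq : (fun t : ℂ => eval (entries (t • A)) f) = fun _ => eval (entries A) f :=
    Continuous.ext_on (dense_compl_singleton (0 : ℂ)) hcont continuous_const
      fun t ht => eval_smul_of_degenerate hf hA ht
  have h0 := congrFun heq 0
  rw [← h0]
  congr 2
  ext c
  simp [entries]

lemma degeneratePairs_subset : degeneratePairs l n ⊆ separatingVariety l n := by
  intro p hp f hf
  exact (eval_of_degenerate hf hp.1).trans (eval_of_degenerate hf hp.2).symm

lemma commonFactorPairs_subset : commonFactorPairs l n ⊆ separatingVariety l n := by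
  rintro _ ⟨P, Q, R, hPQ, rfl⟩
  by_cases hP : P.det = 0
  · exact degeneratePairs_subset ⟨degenerate_mul (degenerate_iff_det_eq_zero.2 hP) R,
      degenerate_mul (degenerate_iff_det_eq_zero.2 (hPQ ▸ hP)) R⟩
  · intro f hf
    -- This element of the group carries `P * R` to `Q * R`.
    have hg : (Q * P⁻¹).det = 1 := by
      rw [Matrix.det_mul, ← hPQ, Matrix.det_nonsing_inv, Ring.inverse_eq_inv', mul_inv_cancel₀ hP]
    have := eval_mul_of_mem_invariants hf hg (P * R)
    rw [Matrix.mul_assoc, Matrix.nonsing_inv_mul_cancel_left _ _ (isUnit_iff_ne_zero.2 hP)] at this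
    exact this.symm

lemma det_submatrix_eq_of_mem {p : PairSpace l n} (hp : p ∈ separatingVariety l n)
    (f : Fin l → Fin n) :
    ((fstMat p).submatrix id f).det = ((sndMat p).submatrix id f).det := by
  obtain ⟨q, hq⟩ : IsPoly fun x : Fin l × Fin n → ℂ =>
      ((Matrix.of fun i j => x (i, j)).submatrix id f).det :=
    IsPoly.det fun i j => IsPoly.coord _
  have hinv : q ∈ invariants l n := by
    intro g A
    rw [hq, hq]
    have : (Matrix.of fun i j => act g⁻¹ A (i, j)).submatrix id f =
        (g⁻¹ : Matrix.SpecialLinearGroup (Fin l) ℂ).1 *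
          (Matrix.of fun i j => A (i, j)).submatrix id f := rfl
    change ((Matrix.of fun i j => act g⁻¹ A (i, j)).submatrix id f).det = _
    rw [this, Matrix.det_mul, (g⁻¹).2, one_mul]
  have := hp q hinv
  rw [hq, hq] at this
  exact this

lemma separatingVariety_eq_union :
    separatingVariety l n = commonFactorPairs l n ∪ degeneratePairs l n := by
  refine Set.Subset.antisymm (fun p hp => ?_)
    (Set.union_subset commonFactorPairs_subset degeneratePairs_subset)
  have hmin := det_submatrix_eq_of_mem hp
  by_cases h : ∀ f : Fin l → Fin n, ((fstMat p).submatrix id f).det = 0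
  · refine Or.inr ⟨?_, ?_⟩
    · by_contra hA
      obtain ⟨f, hf⟩ := exists_det_submatrix_ne_zero hA
      exact hf (h f)
    · by_contra hA
      obtain ⟨f, hf⟩ := exists_det_submatrix_ne_zero hA
      exact hf (hmin f ▸ h f)
  · obtain ⟨f, hf⟩ := not_forall.1 h
    refine Or.inl ⟨(fstMat p).submatrix id f, (sndMat p).submatrix id f,
      ((fstMat p).submatrix id f)⁻¹ * fstMat p, hmin f, ?_⟩
    rw [Matrix.mul_nonsing_inv_cancel_left _ _ (isUnit_iff_ne_zero.2 hf),
      inv_submatrix_mul_eq hmin f,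
      Matrix.mul_nonsing_inv_cancel_left _ _ (isUnit_iff_ne_zero.2 (hmin f ▸ hf)),
      pair_fstMat_sndMat]

lemma isClosed_separatingVariety : IsClosed (separatingVariety l n) := by
  convert! isClosed_setOf_forall_eval_eq_zero
    ((fun f => rename Sum.inl f - rename Sum.inr f) '' (invariants l n : Set (MvPolynomial (Fin l × Fin n) ℂ))) using 1
  refine Set.ext fun p => ?_
  have key : ∀ f : MvPolynomial (Fin l × Fin n) ℂ,
      eval (p : (Fin l × Fin n) ⊕ (Fin l × Fin n) → ℂ) (rename Sum.inl f - rename Sum.inr f) =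
      eval (fun c => p (Sum.inl c)) f - eval (fun c => p (Sum.inr c)) f := fun f =>
    (map_sub _ _ _).trans (congrArg₂ _ (eval_rename _ _ _) (eval_rename _ _ _))
  constructor
  · rintro h _ ⟨f, hf, rfl⟩
    exact (key f).trans (sub_eq_zero.2 (h f hf))
  · intro h f hf
    exact sub_eq_zero.1 ((key f).symm.trans (h _ ⟨f, hf, rfl⟩))

end

/-! ### Irreducibility and dimension of the common-factor pairs. -/

section

lemma isPoly_diagonal_update {σ ι : Type} [DecidableEq ι] {c : (σ → ℂ) → ℂ} (hc : IsPoly c)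
    (i₀ i j : ι) : IsPoly fun x => Matrix.diagonal (Function.update (1 : ι → ℂ) i₀ (c x)) i j := by
  simp only [Matrix.diagonal_apply, Function.update_apply]
  split_ifs
  · exact hc
  · exact IsPoly.const _
  · exact IsPoly.const _

lemma det_diagonal_update {ι : Type} [Fintype ι] [DecidableEq ι] (i₀ : ι) (c : ℂ) :
    (Matrix.diagonal (Function.update (1 : ι → ℂ) i₀ c)).det = c := by
  rw [Matrix.det_diagonal, Finset.prod_update_of_mem (Finset.mem_univ _)]
  simp

variable {l n : ℕ}

/-- A polynomial parametrization of `commonFactorPairs`. -/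
def commonFactorParam (i₀ : Fin l) (n : ℕ)
    (x : ZariskiSpace ((Fin 4 × Fin l × Fin l) ⊕ (Fin l × Fin n) ⊕ Unit)) : PairSpace l n :=
  let U : Fin 4 → Matrix (Fin l) (Fin l) ℂ := fun k => Matrix.of fun i j => x (Sum.inl (k, i, j))
  let R : Matrix (Fin l) (Fin n) ℂ := Matrix.of fun i j => x (Sum.inr (Sum.inl (i, j)))
  let t : ℂ := x (Sum.inr (Sum.inr ()))
  pair
    (U 0 * Matrix.diagonal (Function.update 1 i₀ (t * ((U 2).det * (U 3).det))) * U 1 * R)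
    (U 2 * Matrix.diagonal (Function.update 1 i₀ (t * ((U 0).det * (U 1).det))) * U 3 * R)

lemma range_commonFactorParam (i₀ : Fin l) :
    Set.range (commonFactorParam i₀ n) = commonFactorPairs l n := by
  refine Set.Subset.antisymm ?_ ?_
  · rintro _ ⟨x, rfl⟩
    refine ⟨_, _, _, ?_, rfl⟩
    -- The crossed factors make both determinants `t` times the product of the four determinants of
    -- the `U k`.
    simp only [Matrix.det_mul, det_diagonal_update]
    ring
  · rintro _ ⟨P, Q, R, hPQ, rfl⟩
    have mk : ∀ (U₀ U₁ U₂ U₃ : Matrix (Fin l) (Fin l) ℂ) (t : ℂ), pair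
        (U₀ * Matrix.diagonal (Function.update 1 i₀ (t * (U₂.det * U₃.det))) * U₁ * R)
        (U₂ * Matrix.diagonal (Function.update 1 i₀ (t * (U₀.det * U₁.det))) * U₃ * R) ∈
        Set.range (commonFactorParam i₀ n) := fun U₀ U₁ U₂ U₃ t =>
      ⟨Sum.elim (fun a => (![U₀, U₁, U₂, U₃] a.1) a.2.1 a.2.2)
        (Sum.elim (fun a => R a.1 a.2) fun _ => t), rfl⟩
    by_cases hP : P.det = 0
    · obtain ⟨U, V, rfl⟩ := (degenerate_iff_det_eq_zero.2 hP).exists_eq_mul_diagonal_mul i₀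
      obtain ⟨U', V', rfl⟩ :=
        (degenerate_iff_det_eq_zero.2 (hPQ ▸ hP)).exists_eq_mul_diagonal_mul i₀
      have := mk U V U' V' 0
      simpa only [zero_mul] using this
    · have hcancel : Matrix.diagonal (Function.update (1 : Fin l → ℂ) i₀ P.det) *
          Matrix.diagonal (Function.update (1 : Fin l → ℂ) i₀ (P.det)⁻¹) = 1 := by
        rw [Matrix.diagonal_mul_diagonal, ← Matrix.diagonal_one]
        congr 1
        funext i
        by_cases hi : i = i₀
        · subst hi; simp [hP]
        · simp [hi]
      -- Dividing row `i₀` by `det P` leaves matrices of determinant 1, so the inserted diagonal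
      -- entry is exactly `t = det P`.
      have := mk 1 (Matrix.diagonal (Function.update 1 i₀ (P.det)⁻¹) * P)
        1 (Matrix.diagonal (Function.update 1 i₀ (P.det)⁻¹) * Q) P.det
      rw [Matrix.det_mul, Matrix.det_mul, det_diagonal_update, ← hPQ, inv_mul_cancel₀ hP,
        Matrix.det_one, mul_one, mul_one, Matrix.one_mul, ← Matrix.mul_assoc, ← Matrix.mul_assoc,
        hcancel, Matrix.one_mul, Matrix.one_mul] at this
      exact this

lemma isIrreducible_commonFactorPairs (hl : 0 < l) : IsIrreducible (commonFactorPairs l n) := by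
  rw [← range_commonFactorParam ⟨0, hl⟩]
  refine isIrreducible_range_of_isPoly ?_
  have hU : ∀ k : Fin 4, IsPoly fun x : (Fin 4 × Fin l × Fin l) ⊕ (Fin l × Fin n) ⊕ Unit → ℂ =>
      (Matrix.of fun i j => x (Sum.inl (k, i, j))).det := fun k =>
    IsPoly.det fun i j => IsPoly.coord _
  rintro (⟨i, j⟩ | ⟨i, j⟩)
  · refine IsPoly.matrix_mul (IsPoly.matrix_mul (IsPoly.matrix_mul (fun _ _ => IsPoly.coord _)
      (isPoly_diagonal_update ?_ _)) fun _ _ => IsPoly.coord _) (fun _ _ => IsPoly.coord _) i j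
    exact (IsPoly.coord _).mul ((hU 2).mul (hU 3))
  · refine IsPoly.matrix_mul (IsPoly.matrix_mul (IsPoly.matrix_mul (fun _ _ => IsPoly.coord _)
      (isPoly_diagonal_update ?_ _)) fun _ _ => IsPoly.coord _) (fun _ _ => IsPoly.coord _) i j
    exact (IsPoly.coord _).mul ((hU 0).mul (hU 1))

/-- A polynomial parametrization of `degeneratePairs`. -/
def degenerateParam (i₀ : Fin l) (n : ℕ)
    (x : ZariskiSpace ((Fin 2 × Fin l × Fin l) ⊕ (Fin 2 × Fin l × Fin n))) : PairSpace l n :=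
  let U : Fin 2 → Matrix (Fin l) (Fin l) ℂ := fun k => Matrix.of fun i j => x (Sum.inl (k, i, j))
  let V : Fin 2 → Matrix (Fin l) (Fin n) ℂ := fun k => Matrix.of fun i j => x (Sum.inr (k, i, j))
  pair (U 0 * Matrix.diagonal (Function.update 1 i₀ 0) * V 0)
    (U 1 * Matrix.diagonal (Function.update 1 i₀ 0) * V 1)

lemma range_degenerateParam (i₀ : Fin l) :
    Set.range (degenerateParam i₀ n) = degeneratePairs l n := by
  refine Set.Subset.antisymm ?_ ?_
  · rintro _ ⟨x, rfl⟩
    constructor <;>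
    · refine degenerate_mul (degenerate_iff_det_eq_zero.2 ?_) _
      rw [Matrix.det_mul, det_diagonal_update, mul_zero]
  · rintro p ⟨hA, hB⟩
    obtain ⟨U, V, h⟩ := hA.exists_eq_mul_diagonal_mul i₀
    obtain ⟨U', V', h'⟩ := hB.exists_eq_mul_diagonal_mul i₀
    refine ⟨Sum.elim (fun a => (![U, U'] a.1) a.2.1 a.2.2)
      (fun a => (![V, V'] a.1) a.2.1 a.2.2), ?_⟩
    rw [← pair_fstMat_sndMat p, h, h']
    rfl

lemma isIrreducible_degeneratePairs (hl : 0 < l) : IsIrreducible (degeneratePairs l n) := by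
  rw [← range_degenerateParam ⟨0, hl⟩]
  refine isIrreducible_range_of_isPoly ?_
  rintro (⟨i, j⟩ | ⟨i, j⟩) <;>
  exact IsPoly.matrix_mul (IsPoly.matrix_mul (fun _ _ => IsPoly.coord _)
      (isPoly_diagonal_update (IsPoly.const 0) _)) (fun _ _ => IsPoly.coord _) i j

section Elimination

variable {k R : Type} [Field k] [CommRing R] [Algebra k R] {ι : Type} [Fintype ι] [DecidableEq ι]

lemma det_mem_subalgebra {M : Subalgebra k R} {Y : Matrix ι ι R} (h : ∀ a b, Y a b ∈ M) :
    Y.det ∈ M := by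
  rw [Matrix.det_apply]
  exact M.sum_mem fun _ _ => M.zsmul_mem (M.prod_mem fun _ _ => h _ _) _

lemma adjugate_mem_subalgebra {M : Subalgebra k R} {Y : Matrix ι ι R} {i : ι}
    (h : ∀ a b, a ≠ i → Y a b ∈ M) (b : ι) : Y.adjugate b i ∈ M := by
  rw [Matrix.adjugate_apply]
  refine det_mem_subalgebra fun a c => ?_
  by_cases ha : a = i
  · subst ha
    rw [Matrix.updateRow_self, Pi.single_apply]
    split_ifs
    · exact M.one_mem
    · exact M.zero_mem
  · rw [Matrix.updateRow_ne ha]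
    exact h a c ha

/-- Laplace expansion determines an entry from the determinant and the other entries. -/
lemma entry_mem_subalgebra {M : Subalgebra k R} {I : Ideal R}
    (hdiv : ∀ q y, q ∈ M → q ∉ I → q * y ∈ M → y ∈ M) {Y : Matrix ι ι R} {i j : ι}
    (h : ∀ a b, (a, b) ≠ (i, j) → Y a b ∈ M) (hdet : Y.det ∈ M) (hadj : Y.adjugate j i ∉ I) :
    Y i j ∈ M := by
  have hmem := adjugate_mem_subalgebra (M := M) (Y := Y) (i := i)
    fun a b ha => h a b fun h => ha (Prod.mk.inj h).1
  refine hdiv _ _ (hmem j) hadj ?_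
  have hexp : Y.det = ∑ b, Y i b * Y.adjugate b i := by
    rw [← Matrix.mul_apply, Matrix.mul_adjugate, Matrix.smul_apply, Matrix.one_apply_eq,
      smul_eq_mul, mul_one]
  rw [← Finset.add_sum_erase _ _ (Finset.mem_univ j)] at hexp
  rw [mul_comm, ← sub_eq_of_eq_add hexp]
  refine M.sub_mem hdet (M.sum_mem fun b hb => M.mul_mem (h i b fun h => ?_) (hmem b))
  exact (Finset.mem_erase.1 hb).1 (Prod.mk.inj h).2

/-- The determinant is affine in the entry `(i, j)`, with slope the cofactor. -/
lemma exists_det_eq {Y : Matrix ι ι k} {i j : ι} (hadj : Y.adjugate j i ≠ 0) (d : k) :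
    ∃ Y' : Matrix ι ι k, (∀ a b, (a, b) ≠ (i, j) → Y' a b = Y a b) ∧ Y'.det = d := by
  refine ⟨Y.updateRow i (Y i + ((d - Y.det) / Y.adjugate j i) • Pi.single j 1), ?_, ?_⟩
  · intro a b hab
    by_cases ha : a = i
    · subst ha
      have hb : b ≠ j := fun h => hab (by rw [h])
      simp [hb]
    · rw [Matrix.updateRow_ne ha]
  · rw [Matrix.det_updateRow_add, Matrix.det_updateRow_smul, Matrix.updateRow_eq_self,
      ← Matrix.adjugate_apply, div_mul_cancel₀ _ hadj, add_sub_cancel]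

end Elimination

/-- The matrix `(1 | 0)`. -/
def idMat (h : l ≤ n) : Matrix (Fin l) (Fin n) ℂ :=
  Matrix.of fun i j => if j = Fin.castLE h i then 1 else 0

lemma idMat_submatrix (h : l ≤ n) : (idMat h).submatrix id (Fin.castLE h) = 1 := by
  ext i j
  simp [idMat, Matrix.one_apply, eq_comm]

lemma pair_idMat_mem (h : l ≤ n) : pair (idMat h) (idMat h) ∈ commonFactorPairs l n :=
  ⟨1, 1, idMat h, rfl, by rw [Matrix.one_mul]⟩

/-- Generic matrix of coordinate functions. -/
def genMat {σ : Type} (e : Fin l × Fin n → σ) : Matrix (Fin l) (Fin n) (MvPolynomial σ ℂ) :=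
  Matrix.of fun i j => X (e (i, j))

lemma eval_genMat {σ : Type} (e : Fin l × Fin n → σ) (p : σ → ℂ) :
    (genMat e).map (eval p) = Matrix.of fun i j => p (e (i, j)) := by
  ext i j
  simp [genMat]

lemma eval_det_submatrix_genMat {σ : Type} {ι : Type} [Fintype ι] [DecidableEq ι]
    (e : Fin l × Fin n → σ) (p : σ → ℂ) (r : ι → Fin l) (c : ι → Fin n) :
    eval p ((genMat e).submatrix r c).det =
      ((Matrix.of fun i j => p (e (i, j)) : Matrix (Fin l) (Fin n) ℂ).submatrix r c).det := by
  rw [← eval_genMat e p, RingHom.map_det]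
  rfl

lemma eval_adjugate_submatrix_genMat {σ : Type} {ι : Type} [Fintype ι] [DecidableEq ι]
    (e : Fin l × Fin n → σ) (p : σ → ℂ) (r : ι → Fin l) (c : ι → Fin n) (a b : ι) :
    eval p (((genMat e).submatrix r c).adjugate a b) =
      ((Matrix.of fun i j => p (e (i, j)) : Matrix (Fin l) (Fin n) ℂ).submatrix r c).adjugate
        a b := by
  rw [← eval_genMat e p]
  change ((eval p).mapMatrix ((genMat e).submatrix r c).adjugate) a b = _
  rw [RingHom.map_adjugate]
  rfl

/-- The coordinates used for `commonFactorPairs`: all of the first matrix, and all but one of the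
entries in the first `l` columns of the second. -/
def commonFactorCoord (h : l ≤ n) (i₀ : Fin l) :
    (Fin l × Fin n) ⊕ {q : Fin l × Fin l // q ≠ (i₀, i₀)} → (Fin l × Fin n) ⊕ (Fin l × Fin n) :=
  Sum.map id fun q => (q.1.1, Fin.castLE h q.1.2)

/-- For generic values of these coordinates, the missing entry is solved from equality of
determinants, and the remaining columns of the second matrix are then forced by `R`. -/
lemma card_le_zariskiDim_commonFactorPairs (h : l ≤ n) (i₀ : Fin l) :
    (Fintype.card ((Fin l × Fin n) ⊕ {q : Fin l × Fin l // q ≠ (i₀, i₀)}) : WithBot ℕ∞) ≤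
      zariskiDim (commonFactorPairs l n) := by
  have hinj : Function.Injective (commonFactorCoord h i₀) := by
    refine Function.Injective.sumMap Function.injective_id ?_
    rintro ⟨⟨a, b⟩, hab⟩ ⟨⟨a', b'⟩, hab'⟩ heq
    simpa [Prod.ext_iff] using heq
  refine card_le_zariskiDim hinj (f := fun x =>
    ((fstMat x).submatrix id (Fin.castLE h)).det *
      ((sndMat x).submatrix id (Fin.castLE h)).adjugate i₀ i₀) ?_
    (x₀ := pair (idMat h) (idMat h)) ?_ ?_
  · refine (IsPoly.det fun i j => IsPoly.coord _).mul ?_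
    simp only [Matrix.adjugate_apply]
    refine IsPoly.det fun i j => ?_
    simp only [Matrix.updateRow_apply]
    split_ifs
    · exact IsPoly.const _
    · exact IsPoly.coord _
  · simp [idMat_submatrix]
  · intro x hx
    obtain ⟨hdet, hadj⟩ := mul_ne_zero_iff.1 hx
    obtain ⟨Q, hQ, hQdet⟩ := exists_det_eq hadj ((fstMat x).submatrix id (Fin.castLE h)).det
    refine ⟨_, ⟨(fstMat x).submatrix id (Fin.castLE h), Q,
      ((fstMat x).submatrix id (Fin.castLE h))⁻¹ * fstMat x, hQdet.symm, rfl⟩, ?_⟩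
    rw [Matrix.mul_nonsing_inv_cancel_left _ _ (isUnit_iff_ne_zero.2 hdet)]
    rintro (⟨i, j⟩ | ⟨⟨i, j⟩, hij⟩)
    · rfl
    · have h1 : (((fstMat x).submatrix id (Fin.castLE h))⁻¹ * fstMat x).submatrix id
          (Fin.castLE h) = 1 := by
        rw [← Matrix.nonsing_inv_mul _ (isUnit_iff_ne_zero.2 hdet)]
        rfl
      have h2 : (Q * (((fstMat x).submatrix id (Fin.castLE h))⁻¹ * fstMat x)).submatrix id
          (Fin.castLE h) = Q := by
        conv_rhs => rw [← Matrix.mul_one Q, ← h1]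
        rfl
      exact (congrFun (congrFun h2 i) j).trans (hQ i j hij)

lemma zariskiDim_commonFactorPairs_le (h : l ≤ n) (i₀ : Fin l) :
    zariskiDim (commonFactorPairs l n) ≤
      Fintype.card ((Fin l × Fin n) ⊕ {q : Fin l × Fin l // q ≠ (i₀, i₀)}) := by
  refine zariskiDim_le_card (isIrreducible_commonFactorPairs i₀.pos) (commonFactorCoord h i₀) ?_
  intro M hM hI hdiv
  let c : Fin l → Fin n := Fin.castLE h
  let XA : Matrix (Fin l) (Fin n) (MvPolynomial ((Fin l × Fin n) ⊕ (Fin l × Fin n)) ℂ) :=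
    genMat Sum.inl
  let XB : Matrix (Fin l) (Fin n) (MvPolynomial ((Fin l × Fin n) ⊕ (Fin l × Fin n)) ℂ) :=
    genMat Sum.inr
  have hA : ∀ i j, XA i j ∈ M := fun i j => hM (Sum.inl (i, j))
  have hdetA : (XA.submatrix id c).det ∉ idealOf (commonFactorPairs l n) := fun hmem => by
    have := (eval_det_submatrix_genMat _ _ _ _).symm.trans
      (mem_idealOf.1 hmem _ (pair_idMat_mem h))
    change ((idMat h).submatrix id (Fin.castLE h)).det = 0 at this
    simp [idMat_submatrix] at this
  have hadjB : (XB.submatrix id c).adjugate i₀ i₀ ∉ idealOf (commonFactorPairs l n) :=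
    fun hmem => by
    have := (eval_adjugate_submatrix_genMat _ _ _ _ _ _).symm.trans
      (mem_idealOf.1 hmem _ (pair_idMat_mem h))
    change ((idMat h).submatrix id (Fin.castLE h)).adjugate i₀ i₀ = 0 at this
    simp [idMat_submatrix] at this
  have hdetmem : (XA.submatrix id c).det ∈ M := det_mem_subalgebra fun a b => hA _ _
  have hdetB : (XB.submatrix id c).det ∈ M := by
    have : (XB.submatrix id c).det - (XA.submatrix id c).det ∈ M := hI _ fun p hp => by
      refine (map_sub _ _ _).trans (sub_eq_zero.2 ?_)
      refine (eval_det_submatrix_genMat _ _ _ _).trans (Eq.trans ?_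
        (eval_det_submatrix_genMat _ _ _ _).symm)
      exact (det_submatrix_eq_of_mem (commonFactorPairs_subset hp) c).symm
    simpa using M.add_mem this hdetmem
  have hBne : ∀ a b, (a, b) ≠ (i₀, i₀) → XB.submatrix id c a b ∈ M := fun a b hab =>
    hM (Sum.inr ⟨(a, b), hab⟩)
  have hBc : ∀ a b, XB.submatrix id c a b ∈ M := fun a b => by
    by_cases hab : (a, b) = (i₀, i₀)
    · obtain ⟨rfl, rfl⟩ := Prod.mk.inj hab
      exact entry_mem_subalgebra hdiv hBne hdetB hadjB
    · exact hBne a b hab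
  rintro (⟨i, j⟩ | ⟨i, j⟩)
  · exact hA i j
  refine hdiv _ _ hdetmem hdetA ?_
  have hprod : (XB.submatrix id c * (XA.submatrix id c).adjugate * XA) i j ∈ M := by
    rw [Matrix.mul_apply]
    refine M.sum_mem fun a _ => M.mul_mem ?_ (hA _ _)
    rw [Matrix.mul_apply]
    exact M.sum_mem fun b _ => M.mul_mem (hBc _ _) (adjugate_mem_subalgebra (fun _ _ _ => hA _ _) _)
  -- With `c` selecting the first `l` columns, `det(A_c) B = B_c adj(A_c) A` on all of E, without
  -- invertibility; this recovers the remaining columns of B.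
  have hrel : (XA.submatrix id c).det * X (Sum.inr (i, j)) -
      (XB.submatrix id c * (XA.submatrix id c).adjugate * XA) i j ∈ M := by
    refine hI _ ?_
    rintro _ ⟨P, Q, R, hPQ, rfl⟩
    refine (map_sub _ _ _).trans (sub_eq_zero.2 ?_)
    refine (map_mul _ _ _).trans ?_
    have e1 : eval (pair (P * R) (Q * R)) (XA.submatrix id c).det =
        ((P * R).submatrix id c).det := eval_det_submatrix_genMat _ _ _ _
    have e2 : eval (pair (P * R) (Q * R))
        ((XB.submatrix id c * (XA.submatrix id c).adjugate * XA) i j) =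
        ((Q * R).submatrix id c * ((P * R).submatrix id c).adjugate * (P * R)) i j := by
      rw [Matrix.mul_apply, Matrix.mul_apply, map_sum]
      refine Finset.sum_congr rfl fun a _ => ?_
      rw [map_mul, Matrix.mul_apply, Matrix.mul_apply, map_sum]
      congr 1
      · refine Finset.sum_congr rfl fun b _ => ?_
        rw [map_mul]
        congr 1
        · exact eval_X _
        · exact eval_adjugate_submatrix_genMat _ _ _ _ _ _
      · exact eval_X _
    refine Eq.trans ?_ e2.symm
    refine (congrArg₂ _ e1 (eval_X _)).trans ?_
    have s1 : (P * R).submatrix id c = P * R.submatrix id c := rfl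
    have s2 : (Q * R).submatrix id c = Q * R.submatrix id c := rfl
    have s3 : (Q * R).submatrix id c * ((P * R).submatrix id c).adjugate * (P * R) =
        ((P * R).submatrix id c).det • (Q * R) := by
      rw [s1, s2, Matrix.adjugate_mul_distrib]
      calc Q * R.submatrix id c * ((R.submatrix id c).adjugate * P.adjugate) * (P * R)
          = Q * (R.submatrix id c * (R.submatrix id c).adjugate) * (P.adjugate * P) * R := by
            simp only [Matrix.mul_assoc]
        _ = (P * R.submatrix id c).det • (Q * R) := by
            rw [Matrix.mul_adjugate, Matrix.adjugate_mul, Matrix.det_mul]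
            simp [smul_smul]
    rw [s3]
    rfl
  simpa using M.add_mem hrel hprod

lemma zariskiDim_commonFactorPairs (hl : 0 < l) (h : l ≤ n) :
    zariskiDim (commonFactorPairs l n) = ((l * n + l ^ 2 - 1 : ℕ) : WithBot ℕ∞) := by
  have hcard : Fintype.card ((Fin l × Fin n) ⊕
      {q : Fin l × Fin l // q ≠ ((⟨0, hl⟩ : Fin l), (⟨0, hl⟩ : Fin l))}) = l * n + l ^ 2 - 1 := by
    rw [Fintype.card_sum, Fintype.card_prod, Fintype.card_subtype_compl, Fintype.card_prod,
      Fintype.card_subtype_eq]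
    simp only [Fintype.card_fin]
    have : 0 < l * l := Nat.mul_pos hl hl
    rw [pow_two]
    omega
  rw [← hcard]
  exact le_antisymm (zariskiDim_commonFactorPairs_le h _) (card_le_zariskiDim_commonFactorPairs h _)

end

/-! ### Dimension of the degenerate pairs. -/

section

variable {l m n : ℕ}

/-- Coordinates on the degenerate `(m + 1) × n` matrices: all rows but the last, and the first `m`
entries of the last row. -/
def degenerateCoord (h : m ≤ n) : (Fin m × Fin n) ⊕ Fin m → Fin (m + 1) × Fin n :=
  Sum.elim (fun q => (q.1.castSucc, q.2)) fun k => (Fin.last m, Fin.castLE h k)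

lemma degenerateCoord_injective (h : m ≤ n) : Function.Injective (degenerateCoord h) := by
  rintro (⟨a, b⟩ | a) (⟨a', b'⟩ | a') heq
  · simpa [degenerateCoord] using heq
  · exact absurd (Prod.mk.inj heq).1 (Fin.castSucc_lt_last _).ne
  · exact absurd (Prod.mk.inj heq).1 (Fin.castSucc_lt_last _).ne'
  · simpa [degenerateCoord] using heq

/-- The matrix `T` with the row `w` appended. -/
def appendRow (T : Matrix (Fin m) (Fin n) ℂ) (w : Fin n → ℂ) : Matrix (Fin (m + 1)) (Fin n) ℂ :=
  Matrix.of fun i j => Fin.snoc (α := fun _ => ℂ) (fun a => T a j) (w j) i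

@[simp] lemma appendRow_castSucc (T : Matrix (Fin m) (Fin n) ℂ) (w : Fin n → ℂ) (i : Fin m)
    (j : Fin n) : appendRow T w i.castSucc j = T i j := by
  simp [appendRow]

@[simp] lemma appendRow_last (T : Matrix (Fin m) (Fin n) ℂ) (w : Fin n → ℂ) (j : Fin n) :
    appendRow T w (Fin.last m) j = w j := by
  simp [appendRow]

lemma exists_vecMul_eq {T : Matrix (Fin m) (Fin n) ℂ} {c : Fin m → Fin n}
    (h : (T.submatrix id c).det ≠ 0) (y : Fin m → ℂ) :
    ∃ w : Fin m → ℂ, ∀ k, Matrix.vecMul w T (c k) = y k := by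
  refine ⟨Matrix.vecMul y (T.submatrix id c)⁻¹, fun k => ?_⟩
  have h1 : Matrix.vecMul (Matrix.vecMul y (T.submatrix id c)⁻¹) (T.submatrix id c) = y := by
    rw [Matrix.vecMul_vecMul, Matrix.nonsing_inv_mul _ (isUnit_iff_ne_zero.2 h), Matrix.vecMul_one]
  exact congrFun h1 k

/-- Replace the last row by the combination of the others that has the prescribed first `m` entries.
-/
lemma exists_degenerate_of_det_ne_zero (h : m ≤ n) (A : Matrix (Fin (m + 1)) (Fin n) ℂ)
    (hA : (A.submatrix Fin.castSucc (Fin.castLE h)).det ≠ 0) :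
    ∃ A' : Matrix (Fin (m + 1)) (Fin n) ℂ, Degenerate A' ∧
      ∀ t, A' (degenerateCoord h t).1 (degenerateCoord h t).2 =
        A (degenerateCoord h t).1 (degenerateCoord h t).2 := by
  obtain ⟨w, hw⟩ := exists_vecMul_eq (T := A.submatrix Fin.castSucc id) (c := Fin.castLE h) hA
    fun k => A (Fin.last m) (Fin.castLE h k)
  refine ⟨appendRow (A.submatrix Fin.castSucc id) (Matrix.vecMul w (A.submatrix Fin.castSucc id)),
    ?_, ?_⟩
  · refine ⟨Fin.snoc (α := fun _ => ℂ) (fun i => -w i) 1, fun h0 => ?_, ?_⟩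
    · have := congrFun h0 (Fin.last m)
      simp at this
    · ext j
      simp [Matrix.vecMul, dotProduct, Fin.sum_univ_castSucc]
  · rintro (⟨i, j⟩ | k)
    · simp [degenerateCoord]
    · simpa only [degenerateCoord, Sum.elim_inr, appendRow_last] using hw k

/-- The matrix with an identity block of size `m` and zeros elsewhere. -/
def idMatSucc (h : m ≤ n) : Matrix (Fin (m + 1)) (Fin n) ℂ :=
  appendRow (idMat h) 0

lemma idMatSucc_submatrix (h : m ≤ n) :
    (idMatSucc h).submatrix Fin.castSucc (Fin.castLE h) = 1 := by
  rw [← idMat_submatrix h]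
  ext i j
  simp [idMatSucc]

lemma degenerate_idMatSucc (h : m ≤ n) : Degenerate (idMatSucc h) := by
  refine ⟨Pi.single (Fin.last m) 1, fun h0 => ?_, ?_⟩
  · simpa using congrFun h0 (Fin.last m)
  · rw [Matrix.single_one_vecMul]
    ext j
    simp [idMatSucc]

lemma card_le_zariskiDim_degeneratePairs (h : m ≤ n) :
    (Fintype.card (((Fin m × Fin n) ⊕ Fin m) ⊕ ((Fin m × Fin n) ⊕ Fin m)) : WithBot ℕ∞) ≤
      zariskiDim (degeneratePairs (m + 1) n) := by
  refine card_le_zariskiDim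
    ((degenerateCoord_injective h).sumMap (degenerateCoord_injective h)) (f := fun x =>
    ((fstMat x).submatrix Fin.castSucc (Fin.castLE h)).det *
      ((sndMat x).submatrix Fin.castSucc (Fin.castLE h)).det) ?_
    (x₀ := pair (idMatSucc h) (idMatSucc h)) ?_ ?_
  · exact (IsPoly.det fun i j => IsPoly.coord _).mul (IsPoly.det fun i j => IsPoly.coord _)
  · simp [idMatSucc_submatrix]
  · intro x hx
    obtain ⟨hA, hB⟩ := mul_ne_zero_iff.1 hx
    obtain ⟨A, hAd, hA⟩ := exists_degenerate_of_det_ne_zero h _ hA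
    obtain ⟨B, hBd, hB⟩ := exists_degenerate_of_det_ne_zero h _ hB
    refine ⟨pair A B, ⟨hAd, hBd⟩, ?_⟩
    rintro (t | t)
    · exact hA t
    · exact hB t

/-- On a set where the block `e` of coordinates is a degenerate matrix, the coordinates of
`degenerateCoord` determine the whole block. -/
lemma X_mem_of_degenerate {σ : Type} (h : m ≤ n) {e : Fin (m + 1) × Fin n → σ}
    {Z : Set (ZariskiSpace σ)}
    (hZ : ∀ p ∈ Z, Degenerate (Matrix.of fun i j => p (e (i, j))))
    {p₀ : ZariskiSpace σ} (hp₀ : p₀ ∈ Z)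
    (hp : (Matrix.of fun i j => p₀ (e (i, j))) = idMatSucc h)
    {M : Subalgebra ℂ (MvPolynomial σ ℂ)} (hM : ∀ t, X (e (degenerateCoord h t)) ∈ M)
    (hI : ∀ p ∈ idealOf Z, p ∈ M)
    (hdiv : ∀ q y, q ∈ M → q ∉ idealOf Z → q * y ∈ M → y ∈ M) (c : Fin (m + 1) × Fin n) :
    X (e c) ∈ M := by
  obtain ⟨i, j⟩ := c
  induction i using Fin.lastCases with
  | cast i => exact hM (Sum.inl (i, j))
  | last =>
    -- The minor on the first `m` columns and column `j` vanishes; the cofactor of its corner is the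
    -- leading `m × m` minor, equal to 1 at `p₀`.
    let r : Fin (m + 1) → Fin n := Fin.snoc (α := fun _ => Fin n) (Fin.castLE h) j
    have hmem : ((genMat e).submatrix id r) (Fin.last m) (Fin.last m) ∈ M := by
      refine entry_mem_subalgebra hdiv ?_ ?_ ?_
      · intro a b hab
        induction a using Fin.lastCases with
        | cast a => exact hM (Sum.inl (a, r b))
        | last =>
          induction b using Fin.lastCases with
          | cast b =>
            have : r b.castSucc = Fin.castLE h b := Fin.snoc_castSucc _ _ _
            change X (e (Fin.last m, r b.castSucc)) ∈ M
            rw [this]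
            exact hM (Sum.inr b)
          | last => exact absurd rfl hab
      · exact hI _ fun p hp => (eval_det_submatrix_genMat _ _ _ _).trans
          ((hZ p hp).det_submatrix_eq_zero r)
      · intro hmem
        have := (eval_adjugate_submatrix_genMat _ _ _ _ _ _).symm.trans
          (mem_idealOf.1 hmem _ hp₀)
        rw [hp, Matrix.adjugate_fin_succ_eq_det_submatrix, Matrix.submatrix_submatrix] at this
        have hr : r ∘ (Fin.last m).succAbove = Fin.castLE h := by
          funext b
          simp [r]
        have hl : (id : Fin (m + 1) → Fin (m + 1)) ∘ (Fin.last m).succAbove = Fin.castSucc := by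
          funext b
          simp
        rw [hr, hl, idMatSucc_submatrix] at this
        simp at this
    have : r (Fin.last m) = j := Fin.snoc_last _ _
    change X (e (Fin.last m, r (Fin.last m))) ∈ M at hmem
    rwa [this] at hmem

lemma zariskiDim_degeneratePairs_le (h : m ≤ n) :
    zariskiDim (degeneratePairs (m + 1) n) ≤
      Fintype.card (((Fin m × Fin n) ⊕ Fin m) ⊕ ((Fin m × Fin n) ⊕ Fin m)) := by
  refine zariskiDim_le_card (isIrreducible_degeneratePairs m.succ_pos)
    (Sum.map (degenerateCoord h) (degenerateCoord h)) ?_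
  intro M hM hI hdiv
  have h0 : pair (idMatSucc h) (idMatSucc h) ∈ degeneratePairs (m + 1) n :=
    ⟨degenerate_idMatSucc h, degenerate_idMatSucc h⟩
  rintro (c | c)
  · exact X_mem_of_degenerate h (e := Sum.inl) (fun p hp => hp.1) h0 rfl
      (fun t => hM (Sum.inl t)) hI hdiv c
  · exact X_mem_of_degenerate h (e := Sum.inr) (fun p hp => hp.2) h0 rfl
      (fun t => hM (Sum.inr t)) hI hdiv c

lemma zariskiDim_degeneratePairs (hl : 0 < l) (h : l ≤ n) :
    zariskiDim (degeneratePairs l n) = ((2 * (n + 1) * (l - 1) : ℕ) : WithBot ℕ∞) := by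
  obtain ⟨m, rfl⟩ := Nat.exists_eq_add_of_lt hl
  rw [zero_add] at *
  have hm : m ≤ n := by omega
  have hcard : Fintype.card (((Fin m × Fin n) ⊕ Fin m) ⊕ ((Fin m × Fin n) ⊕ Fin m)) =
      2 * (n + 1) * (m + 1 - 1) := by
    simp only [Fintype.card_sum, Fintype.card_prod, Fintype.card_fin, Nat.add_sub_cancel]
    ring
  rw [← hcard]
  exact le_antisymm (zariskiDim_degeneratePairs_le hm) (card_le_zariskiDim_degeneratePairs hm)

/-! ### Comparison of the two closures, and the case of two rows. -/

/-- The first maximal minor of the first matrix is a polynomial function. -/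
lemma isPoly_minor (h : l ≤ n) : IsPoly fun x : (Fin l × Fin n) ⊕ (Fin l × Fin n) → ℂ =>
    ((fstMat x).submatrix id (Fin.castLE h)).det :=
  IsPoly.det fun _ _ => IsPoly.coord _

lemma minor_eq_zero_on_closure (h : l ≤ n) :
    ∀ p ∈ closure (degeneratePairs l n), ((fstMat p).submatrix id (Fin.castLE h)).det = 0 :=
  eq_zero_on_closure (isPoly_minor h) fun _ hp => hp.1.det_submatrix_eq_zero _

lemma minor_pair_idMat_ne_zero (h : l ≤ n) :
    ((fstMat (pair (idMat h) (idMat h))).submatrix id (Fin.castLE h)).det ≠ 0 := by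
  simp [idMat_submatrix]

lemma commonFactorPairs_not_subset (h : l ≤ n) :
    ¬ closure (commonFactorPairs l n) ⊆ closure (degeneratePairs l n) := fun hsub =>
  minor_pair_idMat_ne_zero h
    (minor_eq_zero_on_closure h _ (hsub (subset_closure (pair_idMat_mem h))))

/-- The stacked matrix is `(P; Q) * R`, so its rank is at most `l`. -/
lemma det_submatrix_fromRows_eq_zero {p : PairSpace l n} (hp : p ∈ commonFactorPairs l n)
    (r : Fin (l + 1) → Fin l ⊕ Fin l) (c : Fin (l + 1) → Fin n) :
    ((Matrix.fromRows (fstMat p) (sndMat p)).submatrix r c).det = 0 := by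
  obtain ⟨P, Q, R, -, rfl⟩ := hp
  have h1 : (Matrix.fromRows (fstMat (pair (P * R) (Q * R))) (sndMat (pair (P * R) (Q * R)))
      ).submatrix r c = (Matrix.fromRows P Q).submatrix r id * R.submatrix id c := by
    rw [fstMat_pair, sndMat_pair, ← Matrix.fromRows_mul]
    rfl
  by_contra hdet
  have h2 := Matrix.rank_of_det_ne_zero hdet
  rw [h1] at h2
  have h3 := (Matrix.rank_mul_le_left ((Matrix.fromRows P Q).submatrix r id)
    (R.submatrix id c)).trans (Matrix.rank_le_card_width _)
  rw [h2] at h3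
  simp at h3

lemma degeneratePairs_not_subset (hl : 3 ≤ l) (h : l + 1 ≤ n) :
    ¬ closure (degeneratePairs l n) ⊆ closure (commonFactorPairs l n) := by
  obtain ⟨m, rfl⟩ : ∃ m, l = m + 3 := ⟨l - 3, by omega⟩
  -- Take the first `l - 1` rows of `A` and the first two of `B`. Degeneracy of `B` allows two
  -- independent rows precisely because `l ≥ 3`.
  let r : Fin (m + 3 + 1) → Fin (m + 3) ⊕ Fin (m + 3) := fun k =>
    if hk : k.1 < m + 2 then Sum.inl ⟨k.1, by omega⟩ else Sum.inr ⟨k.1 - (m + 2), by omega⟩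
  let A : Matrix (Fin (m + 3)) (Fin n) ℂ := Matrix.of fun i j =>
    if i.1 = j.1 ∧ i.1 < m + 2 then 1 else 0
  let B : Matrix (Fin (m + 3)) (Fin n) ℂ := Matrix.of fun i j =>
    if i.1 + (m + 2) = j.1 ∧ i.1 < 2 then 1 else 0
  have hA : Degenerate A := by
    refine ⟨Pi.single ⟨m + 2, by omega⟩ 1, fun h0 => ?_, ?_⟩
    · simpa using congrFun h0 ⟨m + 2, by omega⟩
    · rw [Matrix.single_one_vecMul]
      ext j
      simp [A]
  have hB : Degenerate B := by
    refine ⟨Pi.single ⟨m + 2, by omega⟩ 1, fun h0 => ?_, ?_⟩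
    · simpa using congrFun h0 ⟨m + 2, by omega⟩
    · rw [Matrix.single_one_vecMul]
      ext j
      simp [B]
  have hpoly : IsPoly fun x : (Fin (m + 3) × Fin n) ⊕ (Fin (m + 3) × Fin n) → ℂ =>
      ((Matrix.fromRows (fstMat x) (sndMat x)).submatrix r (Fin.castLE h)).det := by
    refine IsPoly.det fun i j => ?_
    simp only [Matrix.submatrix_apply]
    rcases r i with a | a
    · exact IsPoly.coord _
    · exact IsPoly.coord _
  intro hsub
  have h0 := eq_zero_on_closure hpoly
    (fun p hp => det_submatrix_fromRows_eq_zero hp r (Fin.castLE h)) (pair A B)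
    (hsub (subset_closure ⟨hA, hB⟩))
  have h1 : (Matrix.fromRows A B).submatrix r (Fin.castLE h) = 1 := by
    ext i j
    rw [Matrix.submatrix_apply, Matrix.one_apply]
    by_cases hi : i.1 < m + 2
    · simp [r, hi, A, Fin.ext_iff]
    · have h2 : i.1 ≤ 1 + (m + 2) := by omega
      have h3 : i.1 - (m + 2) + (m + 2) = i.1 := by omega
      simp [r, hi, B, Fin.ext_iff, h2, h3]
  change ((Matrix.fromRows A B).submatrix r (Fin.castLE h)).det = 0 at h0
  rw [h1, Matrix.det_one] at h0
  exact one_ne_zero h0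

/-- Placing the zero of the diagonal factor at 0 for one matrix and at 1 for the other, each uses a
different row of its right factor; those two rows form a common `R`. -/
lemma separatingVariety_two : separatingVariety 2 n = commonFactorPairs 2 n := by
  rw [separatingVariety_eq_union, Set.union_eq_left]
  rintro p ⟨hA, hB⟩
  obtain ⟨U, V, h⟩ := hA.exists_eq_mul_diagonal_mul 0
  obtain ⟨U', V', h'⟩ := hB.exists_eq_mul_diagonal_mul 1
  refine ⟨U * Matrix.diagonal ![0, 1], U' * Matrix.diagonal ![1, 0], Matrix.of ![V' 0, V 1],
    ?_, ?_⟩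
  · simp [Matrix.det_mul, Matrix.det_diagonal]
  · rw [← pair_fstMat_sndMat p, h, h']
    congr 1
    · ext i j
      simp [Matrix.mul_apply, Fin.sum_univ_two, Matrix.diagonal_apply]
    · ext i j
      simp [Matrix.mul_apply, Fin.sum_univ_two, Matrix.diagonal_apply]

/-! ### The intersection for three rows. -/

/-- Coordinates on the degenerate pairs of `3 × n` matrices with a common factor. -/
def intersectionCoord (h : 3 ≤ n) : (Fin 2 × Fin n) ⊕ Fin 2 ⊕ Fin n ⊕ Fin 3 ⊕ Fin 2 →
    (Fin 3 × Fin n) ⊕ (Fin 3 × Fin n) :=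
  Sum.elim (fun q => Sum.inl (q.1.castSucc, q.2)) <|
  Sum.elim (fun k => Sum.inl (2, Fin.castLE (by omega) k)) <|
  Sum.elim (fun j => Sum.inr (0, j)) <|
  Sum.elim (fun k => Sum.inr (1, Fin.castLE h k)) fun k => Sum.inr (2, Fin.castLE (by omega) k)

lemma intersectionCoord_injective (h : 3 ≤ n) : Function.Injective (intersectionCoord h) := by
  have h2 : ∀ a : Fin 2, a.castSucc ≠ (2 : Fin 3) := by decide
  rintro (⟨a, b⟩ | a | a | a | a) (⟨a', b'⟩ | a' | a' | a' | a') heq <;>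
    simp [intersectionCoord, h2, (h2 _).symm] at heq ⊢ <;> exact heq

/-- Let `R` have rows A₀, A₁, B₀. Then A₂ is a combination of A₀, A₁ (2 parameters), B₁ of the rows
of `R` (3), and B₂ of B₀, B₁ (2). With the 3n entries of `R` this gives 3n + 7. -/
lemma card_le_zariskiDim_inter (h : 3 ≤ n) :
    (Fintype.card ((Fin 2 × Fin n) ⊕ Fin 2 ⊕ Fin n ⊕ Fin 3 ⊕ Fin 2) : WithBot ℕ∞) ≤
      zariskiDim (commonFactorPairs 3 n ∩ degeneratePairs 3 n) := by
  have h2 : 2 ≤ n := by omega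
  refine card_le_zariskiDim (intersectionCoord_injective h) (f := fun x =>
    ((Matrix.of ![fstMat x 0, fstMat x 1, sndMat x 0]).submatrix id (Fin.castLE h)).det *
    (((fstMat x).submatrix Fin.castSucc (Fin.castLE h2)).det *
      ((sndMat x).submatrix Fin.castSucc (Fin.castLE h2)).det)) ?_
    -- The extra 1 in the first row of the second matrix makes the leading block of `R` invertible.
    (x₀ := pair (Matrix.of fun i j => if j.1 = i.1 then 1 else 0)
      (Matrix.of fun i j => if j.1 = i.1 ∨ (i = 0 ∧ j.1 = 2) then 1 else 0)) ?_ ?_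
  · refine IsPoly.mul (IsPoly.det fun i j => ?_) ((IsPoly.det fun i j => IsPoly.coord _).mul
      (IsPoly.det fun i j => IsPoly.coord _))
    fin_cases i
    · exact IsPoly.coord _
    · exact IsPoly.coord _
    · exact IsPoly.coord _
  · simp [Matrix.det_fin_three, Matrix.det_fin_two]
  · intro x hx
    obtain ⟨hR, hAB⟩ := mul_ne_zero_iff.1 hx
    obtain ⟨hA, hB⟩ := mul_ne_zero_iff.1 hAB
    set R : Matrix (Fin 3) (Fin n) ℂ := Matrix.of ![fstMat x 0, fstMat x 1, sndMat x 0]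
    obtain ⟨a, ha⟩ := exists_vecMul_eq (T := (fstMat x).submatrix Fin.castSucc id)
      (c := Fin.castLE h2) hA fun k => fstMat x 2 (Fin.castLE h2 k)
    obtain ⟨q, hq⟩ := exists_vecMul_eq hR fun k => sndMat x 1 (Fin.castLE h k)
    let T : Matrix (Fin 2) (Fin n) ℂ := Matrix.of ![sndMat x 0, Matrix.vecMul q R]
    have hT : T.submatrix id (Fin.castLE h2) =
        (sndMat x).submatrix Fin.castSucc (Fin.castLE h2) := by
      ext i j
      fin_cases i
      · rfl
      · exact hq (Fin.castLE (by omega) j)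
    obtain ⟨b, hb⟩ := exists_vecMul_eq (T := T) (c := Fin.castLE h2) (by rw [hT]; exact hB)
      fun k => sndMat x 2 (Fin.castLE h2 k)
    -- In both matrices the last row depends on the first two, so both determinants vanish.
    let P : Matrix (Fin 3) (Fin 3) ℂ := Matrix.of ![![1, 0, 0], ![0, 1, 0], ![a 0, a 1, 0]]
    let Q : Matrix (Fin 3) (Fin 3) ℂ :=
      Matrix.of ![![0, 0, 1], q, ![b 1 * q 0, b 1 * q 1, b 0 + b 1 * q 2]]
    have hP : P.det = 0 := by simp [P, Matrix.det_fin_three]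
    have hQ : Q.det = 0 := by
      simp [Q, Matrix.det_fin_three]
      ring
    refine ⟨pair (P * R) (Q * R), ⟨⟨P, Q, R, hP.trans hQ.symm, rfl⟩,
      degenerate_mul (degenerate_iff_det_eq_zero.2 hP) R,
      degenerate_mul (degenerate_iff_det_eq_zero.2 hQ) R⟩, ?_⟩
    have hP0 : (P * R) 0 = fstMat x 0 := by
      ext j; simp [Matrix.mul_apply, Fin.sum_univ_three, P, R]
    have hP1 : (P * R) 1 = fstMat x 1 := by
      ext j; simp [Matrix.mul_apply, Fin.sum_univ_three, P, R]
    have hP2 : (P * R) 2 = Matrix.vecMul a ((fstMat x).submatrix Fin.castSucc id) := by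
      ext j
      simp [Matrix.mul_apply, Fin.sum_univ_three, P, R, Matrix.vecMul, dotProduct]
    have hQ0 : (Q * R) 0 = sndMat x 0 := by
      ext j; simp [Matrix.mul_apply, Fin.sum_univ_three, Q, R]
    have hQ1 : (Q * R) 1 = Matrix.vecMul q R := rfl
    have hQ2 : (Q * R) 2 = Matrix.vecMul b T := by
      ext j
      simp [Matrix.mul_apply, Fin.sum_univ_three, Q, R, T, Matrix.vecMul_eq_sum, Fin.sum_univ_two]
      ring
    rintro (⟨i, j⟩ | k | j | k | k)
    · fin_cases i
      · exact congrFun hP0 j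
      · exact congrFun hP1 j
    · exact (congrFun hP2 _).trans (ha k)
    · exact congrFun hQ0 j
    · exact (congrFun hQ1 _).trans (hq k)
    · exact (congrFun hQ2 _).trans (hb k)

lemma zariskiDim_mono {σ : Type} {Z W : Set (ZariskiSpace σ)} (h : W ⊆ Z) :
    zariskiDim W ≤ zariskiDim Z :=
  ringKrullDim_le_of_surjective
    (Ideal.Quotient.factor (vanishingIdeal_anti_mono h : idealOf Z ≤ idealOf W))
    (Ideal.Quotient.factor_surjective _)

lemma le_of_add_one_le_natCast {d : WithBot ℕ∞} {k : ℕ} (h : d + 1 ≤ ((k + 1 : ℕ) : WithBot ℕ∞)) :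
    d ≤ (k : WithBot ℕ∞) := by
  induction d with
  | bot => exact bot_le
  | coe d =>
    have h' : d + 1 ≤ ((k + 1 : ℕ) : ℕ∞) := by exact_mod_cast h
    have : d ≤ (k : ℕ∞) := by
      rw [Nat.cast_add, Nat.cast_one] at h'
      exact (ENat.add_le_add_iff_right ENat.one_ne_top).1 h'
    exact_mod_cast this

end

end SepVar

end

/-! ### The main theorem. -/

open SepVar in
theorem theorem1p3 :
    (∀ l n : ℕ, 3 ≤ l → l + 1 ≤ n →
      ∃ C₁ C₂ : Set (SepVar.separatingVariety l n),
        C₁ ≠ C₂ ∧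
        irreducibleComponents (SepVar.separatingVariety l n) = {C₁, C₂} ∧
        SepVar.zariskiDim (Subtype.val '' C₁) = ((l * n + l ^ 2 - 1 : ℕ) : WithBot ℕ∞) ∧
        SepVar.zariskiDim (Subtype.val '' C₂) = ((2 * (n + 1) * (l - 1) : ℕ) : WithBot ℕ∞) ∧
        IsClosed (Subtype.val '' (C₁ ∩ C₂)) ∧
        SepVar.zariskiDim (Subtype.val '' (C₁ ∩ C₂)) ≤
          ((l * n + l ^ 2 - 2 : ℕ) : WithBot ℕ∞) ∧
        (l = 3 → SepVar.zariskiDim (Subtype.val '' (C₁ ∩ C₂)) =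
          ((l * n + l ^ 2 - 2 : ℕ) : WithBot ℕ∞))) ∧
    (∀ n : ℕ, IsIrreducible (SepVar.separatingVariety 2 n)) := by
  refine ⟨fun l n hl hn => ?_, fun n => ?_⟩
  · have hpos : 0 < l := by omega
    have hln : l ≤ n := by omega
    have hirrE := isIrreducible_commonFactorPairs (n := n) hpos
    have hirrF := isIrreducible_degeneratePairs (n := n) hpos
    have hES : closure (commonFactorPairs l n) ⊆ separatingVariety l n :=
      closure_minimal commonFactorPairs_subset isClosed_separatingVariety
    have hFS : closure (degeneratePairs l n) ⊆ separatingVariety l n :=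
      closure_minimal degeneratePairs_subset isClosed_separatingVariety
    have hS : separatingVariety l n =
        closure (commonFactorPairs l n) ∪ closure (degeneratePairs l n) :=
      Set.Subset.antisymm
        (separatingVariety_eq_union.subset.trans
          (Set.union_subset_union subset_closure subset_closure))
        (Set.union_subset hES hFS)
    have himE : ((↑) : separatingVariety l n → PairSpace l n) ''
        (((↑) : separatingVariety l n → PairSpace l n) ⁻¹' closure (commonFactorPairs l n)) =
        closure (commonFactorPairs l n) := by
      rw [Subtype.image_preimage_coe, Set.inter_eq_right]
      exact hES
    have himF : ((↑) : separatingVariety l n → PairSpace l n) ''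
        (((↑) : separatingVariety l n → PairSpace l n) ⁻¹' closure (degeneratePairs l n)) =
        closure (degeneratePairs l n) := by
      rw [Subtype.image_preimage_coe, Set.inter_eq_right]
      exact hFS
    have himEF : ((↑) : separatingVariety l n → PairSpace l n) ''
        (((↑) : separatingVariety l n → PairSpace l n) ⁻¹' closure (commonFactorPairs l n) ∩
          ((↑) : separatingVariety l n → PairSpace l n) ⁻¹' closure (degeneratePairs l n)) =
        closure (commonFactorPairs l n) ∩ closure (degeneratePairs l n) := by
      rw [Set.image_inter Subtype.val_injective, himE, himF]
    have hle : zariskiDim (closure (commonFactorPairs l n) ∩ closure (degeneratePairs l n)) ≤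
        ((l * n + l ^ 2 - 2 : ℕ) : WithBot ℕ∞) := by
      refine le_of_add_one_le_natCast ?_
      have hnum : l * n + l ^ 2 - 2 + 1 = l * n + l ^ 2 - 1 := by
        have : 0 < l ^ 2 := by positivity
        have : 0 < l * n := Nat.mul_pos hpos (by omega)
        omega
      rw [hnum, ← zariskiDim_commonFactorPairs hpos hln,
        ← zariskiDim_closure (commonFactorPairs l n)]
      -- The leading minor of the first matrix vanishes on the closure of F but not at the point `(1
      -- | 0)`, `(1 | 0)` of E.
      exact zariskiDim_add_one_le (isIrreducible_iff_closure.2 hirrE) Set.inter_subset_left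
        (isPoly_minor hln) (fun p hp => minor_eq_zero_on_closure hln p hp.2)
        (subset_closure (pair_idMat_mem hln)) (minor_pair_idMat_ne_zero hln)
    refine ⟨(↑) ⁻¹' closure (commonFactorPairs l n), (↑) ⁻¹' closure (degeneratePairs l n),
      fun h => ?_, ?_, ?_, ?_, ?_, ?_, ?_⟩
    · exact commonFactorPairs_not_subset hln (by rw [← himE, h, himF])
    · exact irreducibleComponents_subtype_eq_pair (isIrreducible_iff_closure.2 hirrE)
        (isIrreducible_iff_closure.2 hirrF) isClosed_closure isClosed_closure hS
        (commonFactorPairs_not_subset hln) (degeneratePairs_not_subset hl hn)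
    · rw [himE, zariskiDim_closure, zariskiDim_commonFactorPairs hpos hln]
    · rw [himF, zariskiDim_closure, zariskiDim_degeneratePairs hpos hln]
    · rw [himEF]
      exact isClosed_closure.inter isClosed_closure
    · rw [himEF]
      exact hle
    · rintro rfl
      rw [himEF]
      refine le_antisymm hle (le_trans ?_ ((card_le_zariskiDim_inter hln).trans
        (zariskiDim_mono (Set.inter_subset_inter subset_closure subset_closure))))
      simp only [Fintype.card_sum, Fintype.card_prod, Fintype.card_fin]
      refine Nat.cast_le.2 ?_
      omega
  · rw [separatingVariety_two]
    exact isIrreducible_commonFactorPairs two_pos
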